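/- Let $\mathcal{S}$ be a database schema, i.e. a finite set of relation names, each with a signature $[n,m]$, $n\ge m\ge 1$, meaning that it has arity $n$ and that its first $m$ positions form its primary key. A fact is an expression $R(a_1,\dots,a_n)$ with $R\in\mathcal{S}$ of arity $n$ and constants $a_1,\dots,a_n$; two facts are key-equal if they have the same relation name and agree on all primary-key positions. An uncertain database is a finite set of facts; it is consistent if it contains no two distinct key-equal facts, and a repair of an uncertain database $\mathbf{db}$ is a maximal consistent subset of $\mathbf{db}$. For a Boolean conjunctive query $q$ (a finite set of atoms, read as the existential closure of their conjunction), $\mathsf{CERTAINTY}(q)$ is the decision problem that takes as input an uncertain database $\mathbf{db}$ and asks whether every repair of $\mathbf{db}$ satisfies $q$; the schema and the query are fixed and are not part of the input. Let $k\ge 2$, let $R_1,\dots,R_k$ be distinct relation names of $\mathcal{S}$, each of signature $[2,1]$, and let $x_1,\dots,x_k$ be distinct variables. For the cycle query $$C_k=\{R_1(\underline{x_1},x_2),\,R_2(\underline{x_2},x_3),\,\dots,\,R_{k-1}(\underline{x_{k-1}},x_k),\,R_k(\underline{x_k},x_1)\}$$ (primary keys underlined), the problem $\mathsf{CERTAINTY}(C_k)$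 is in $\mathbf{P}$, that is, it is decidable by a deterministic Turing machine in time polynomial in the size of $\mathbf{db}$. -/

import Mathlib

namespace CQA

/-- A database schema over a finite set `Rel` of relation names: every relation name has a
signature `[n, m]` with `n ≥ m ≥ 1`, where `n` is the arity and the first `m` positions form the
primary key. -/
structure Schema (Rel : Type) where
  arity : Rel → ℕ
  keyLen : Rel → ℕ
  one_le_keyLen : ∀ R, 1 ≤ keyLen R
  keyLen_le_arity : ∀ R, keyLen R ≤ arity R

/-- Variables. -/
abbrev Var : Type := ℕ

/-- Constants: a countably infinite set, represented by finite bit strings. -/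
abbrev Const : Type := List Bool

/-- A term is a variable or a constant. -/
inductive Term where
  | var : Var → Term
  | const : Const → Term

/-- The extension of a valuation to terms; it is the identity on constants. -/
def Term.value (θ : Var → Const) : Term → Const
  | .var x => θ x
  | .const c => c

/-- An expression `R(t₁, …, tₙ)`, where `n` is the arity of `R` and the `tᵢ` are in `T`. -/
@[ext]
structure RelExpr {Rel : Type} (S : Schema Rel) (T : Type) where
  rel : Rel
  args : List T
  length_args : args.length = S.arity rel

/-- Atoms: the arguments are variables and constants. -/
abbrev Atom {Rel : Type} (S : Schema Rel) : Type := RelExpr S Term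

/-- Facts: the arguments are constants. -/
abbrev Fact {Rel : Type} (S : Schema Rel) : Type := RelExpr S Const

/-- The fact obtained from an atom by applying a valuation. -/
def Atom.subst {Rel : Type} {S : Schema Rel} (θ : Var → Const) (F : Atom S) : Fact S where
  rel := F.rel
  args := F.args.map (Term.value θ)
  length_args := by rw [List.length_map, F.length_args]

/-- Two facts are key-equal if they have the same relation name and the same primary key value. -/
def KeyEqual {Rel : Type} {S : Schema Rel} (A B : Fact S) : Prop :=
  A.rel = B.rel ∧ A.args.take (S.keyLen A.rel) = B.args.take (S.keyLen B.rel)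

/-- An uncertain database is a finite set of facts. -/
abbrev Database {Rel : Type} (S : Schema Rel) : Type := Finset (Fact S)

/-- A database is consistent if it does not contain two distinct key-equal facts. -/
def Consistent {Rel : Type} {S : Schema Rel} (db : Database S) : Prop :=
  ∀ A ∈ db, ∀ B ∈ db, KeyEqual A B → A = B

/-- A repair of `db` is a maximal consistent subset of `db`. -/
def IsRepair {Rel : Type} {S : Schema Rel} (db r : Database S) : Prop :=
  Maximal (fun s : Database S => s ⊆ db ∧ Consistent s) r

/-- A Boolean conjunctive query is a finite set of atoms. -/
abbrev Query {Rel : Type} (S : Schema Rel) : Type := Finset (Atom S)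

/-- `db ⊨ q`: some valuation maps every atom of `q` to a fact of `db`. -/
def Satisfies {Rel : Type} {S : Schema Rel} (db : Database S) (q : Query S) : Prop :=
  ∃ θ : Var → Const, ∀ F ∈ q, Atom.subst θ F ∈ db

/-- `CERTAINTY(q)`: the set of all uncertain databases every repair of which satisfies `q`. -/
def certainty {Rel : Type} {S : Schema Rel} (q : Query S) : Set (Database S) :=
  {db | ∀ r : Database S, IsRepair db r → Satisfies r q}

open Classical in
/-- The cycle query `{R₀(x₀; x₁), R₁(x₁; x₂), …, Rₖ₋₁(xₖ₋₁; x₀)}` (indices from `0` to `k - 1`). -/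
noncomputable def cycleQuery {Rel : Type} (S : Schema Rel) {k : ℕ} (R : Fin k → Rel)
    (hR : ∀ i, S.arity (R i) = 2) : Query S :=
  Finset.univ.image fun i : Fin k =>
    { rel := R i
      args := [Term.var i.val, Term.var ((i.val + 1) % k)]
      length_args := (hR i).symm }

/-- The finite alphabet in which databases are written down. -/
inductive Sym (Rel : Type) where
  | rel : Rel → Sym Rel
  | bit : Bool → Sym Rel
  | sep : Sym Rel

/-- A constant is written as its bits followed by an end marker. -/
def encodeConst {Rel : Type} (c : Const) : List (Sym Rel) :=
  c.map Sym.bit ++ [Sym.sep]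

/-- A fact is written as its relation name followed by its arguments. -/
def encodeFact {Rel : Type} {S : Schema Rel} (A : Fact S) : List (Sym Rel) :=
  Sym.rel A.rel :: A.args.flatMap encodeConst

/-- The word `w` is an encoding of `db`: it lists the facts of `db`, in any order, possibly with
repetitions. -/
def Encodes {Rel : Type} {S : Schema Rel} (w : List (Sym Rel)) (db : Database S) : Prop :=
  ∃ l : List (Fact S), (∀ A, A ∈ l ↔ A ∈ db) ∧ w = l.flatMap encodeFact

/-- The language of a decision problem on uncertain databases: all encodings of yes-instances. -/
def problemLanguage {Rel : Type} {S : Schema Rel} (Q : Set (Database S)) :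
    Set (List (Sym Rel)) :=
  {w | ∃ db ∈ Q, Encodes w db}

/-- The complexity class `P`: some deterministic Turing machine (with finitely many stacks,
and with finite alphabets) decides membership of every word in `L` in a number of steps that is
bounded by a polynomial in the length of the word. -/
def InP {Γ : Type} (L : Set (List Γ)) : Prop :=
  ∃ f : List Γ → Bool, (∀ w, f w = true ↔ w ∈ L) ∧
    ∃ M : Turing.TM2ComputableInPolyTime (id : List Γ → List Γ) Computability.encodeBool f,
      ∀ s, Finite (M.tm.Γ s)

end CQA

/-! Number the relations from `0` and read a fact R_i(a, b) as an edge from (i, a) to (i + 1 mod k,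
b). Facts of these relations are key-equal exactly when their edges have the same source, so a
repair amounts to a choice of one outgoing edge at every vertex that has one (`not_certain_iff`). A
repair satisfies the query exactly when its edges contain a closed walk of length k
(`satisfies_iff`). Every edge advances one layer, so the length of any closed walk is a multiple of
k, and a positive length other than k exceeds k.

A choice without closed walks of length k exists if and only if every edge leads to a bad edge: one
on no closed walk of length k, or one that starts an elementary cycle longer than k. For sufficiency
(`exists_choice`), take a maximal partial choice. If it leaves out a vertex, maximality forces
everything reachable from there to be left out as well; but then a reachable bad edge could be
added, alone or together with its long cycle. For necessity (`exists_of_choice`), follow the choice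
through good edges only: it never gets stuck, hence runs into a cycle, whose length is a multiple of
k but not k, so that its edges are bad after all.

Badness is easy to test because k is fixed. By layering, a long cycle is a k-step walk ending away
from its start together with a return path that avoids the inner vertices of the walk. It therefore
suffices to enumerate the polynomially many k-step walks and to test reachability for each;
`certainGraph` does this and `certainGraph_iff` states its correctness.

To obtain a Turing machine, `PT` isolates the functions computed in polynomial time by structured
stack programs. It is closed under composition, pairing, branching and folds of bounded growth,
which suffices for the parser and the graph search (`PT.decideCycle`). `Run.leads` and `inP_of_pt`
compile such programs into machines. -/

namespace CQA

/-! ### A structured programming language over finitely many stacks of bits -/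

/-- Structured programs over a family of stacks of bits. -/
inductive Prog where
  | push (k : ℕ) (b : Bool)
  | pop (k : ℕ)
  | seq (p q : Prog)
  | cases (k : ℕ) (p q r : Prog)
  | loop (k : ℕ) (p : Prog)

/-- A store assigns a content to every stack. -/
abbrev Store : Type := ℕ → List Bool

/-- `Run c s s' t`: started in `s`, the program `c` halts in `s'` after at most `t` steps. -/
inductive Run : Prog → Store → Store → ℕ → Prop
  | push (k b s) : Run (.push k b) s (Function.update s k (b :: s k)) 1
  | pop (k s) : Run (.pop k) s (Function.update s k (s k).tail) 1
  | seq {p q s s' s'' t t'} : Run p s s' t → Run q s' s'' t' → Run (.seq p q) s s'' (t + t')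
  | cases_nil {k p q r s s' t} : s k = [] → Run p s s' t → Run (.cases k p q r) s s' (t + 1)
  | cases_false {k p q r s s' t l} : s k = false :: l → Run q s s' t →
      Run (.cases k p q r) s s' (t + 1)
  | cases_true {k p q r s s' t l} : s k = true :: l → Run r s s' t →
      Run (.cases k p q r) s s' (t + 1)
  | loop_nil {k p s} : s k = [] → Run (.loop k p) s s 1
  | loop_cons {k p s s' s'' t t'} : s k ≠ [] → Run p s s' t → Run (.loop k p) s' s'' t' →
      Run (.loop k p) s s'' (t + t' + 1)
  | mono {c s s' t t'} : Run c s s' t → t ≤ t' → Run c s s' t'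

theorem Run.congr {c s s' s'' t t'} (h : Run c s s' t) (hs : s' = s'') (ht : t ≤ t') :
    Run c s s'' t' := hs ▸ h.mono ht

/-- Each unit of time pushes at most one bit, so running time bounds output size. Composing
polynomial bounds rests on this, through `PT.size_le`. -/
theorem Run.length_le {c s s' t} (h : Run c s s' t) (k : ℕ) :
    (s' k).length ≤ (s k).length + t := by
  induction h with
  | push j b s => by_cases hk : k = j
                  · subst hk; simp
                  · simp [hk]
  | pop j s => by_cases hk : k = j
               · subst hk; simp; omega
               · simp [hk]
  | loop_nil => omega
  | _ => omega

/-- The store that agrees with `s` below `n`, has the contents `a`, `b`, `c`, `d` on the next four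
stacks, and is empty above. -/
def frame (s : Store) (n : ℕ) (a b c d : List Bool) : Store := fun m =>
  if m < n then s m else if m = n then a else if m = n + 1 then b else if m = n + 2 then c
  else if m = n + 3 then d else []

section frame
variable (s : Store) (n : ℕ) (a b c d x : List Bool)

@[simp] theorem frame_zero : frame s n a b c d n = a := by simp [frame]
@[simp] theorem frame_one : frame s n a b c d (n + 1) = b := by simp [frame]
@[simp] theorem frame_two : frame s n a b c d (n + 2) = c := by simp [frame]
@[simp] theorem frame_three : frame s n a b c d (n + 3) = d := by simp [frame]

@[simp] theorem update_frame_zero :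
    Function.update (frame s n a b c d) n x = frame s n x b c d := by
  ext1 m; simp only [Function.update_apply, frame]; split_ifs <;> first | rfl | omega
@[simp] theorem update_frame_one :
    Function.update (frame s n a b c d) (n + 1) x = frame s n a x c d := by
  ext1 m; simp only [Function.update_apply, frame]; split_ifs <;> first | rfl | omega
@[simp] theorem update_frame_two :
    Function.update (frame s n a b c d) (n + 2) x = frame s n a b x d := by
  ext1 m; simp only [Function.update_apply, frame]; split_ifs <;> first | rfl | omega
@[simp] theorem update_frame_three :
    Function.update (frame s n a b c d) (n + 3) x = frame s n a b c x := by
  ext1 m; simp only [Function.update_apply, frame]; split_ifs <;> first | rfl | omega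

/-- Lets a subprogram run at offset `n + 1` with the stack `n` protected as part of the lower store.
-/
theorem frame_shift_one :
    frame s n x a [] [] = frame (frame s n x [] [] []) (n + 1) a [] [] [] := by
  ext1 m; simp only [frame]; split_ifs <;> first | rfl | omega
theorem frame_shift_two :
    frame s n x b a [] = frame (frame s n x b [] []) (n + 2) a [] [] [] := by
  ext1 m; simp only [frame]; split_ifs <;> first | rfl | omega

end frame

/-! ### Basic programs -/

namespace Prog

/-- Empty a stack. -/
def clear (i : ℕ) : Prog := .loop i (.pop i)

/-- Move the stack `i` onto `j`, reversing it. -/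
def move (i j : ℕ) : Prog :=
  .loop i (.cases i (.pop i) (.seq (.pop i) (.push j false)) (.seq (.pop i) (.push j true)))

/-- Move the stack `i` onto both `j` and `k`, reversing it. -/
def fork (i j k : ℕ) : Prog :=
  .loop i (.cases i (.pop i) (.seq (.pop i) (.seq (.push j false) (.push k false)))
    (.seq (.pop i) (.seq (.push j true) (.push k true))))

/-- Put a word on a stack. -/
def pushWord (i : ℕ) : List Bool → Prog
  | [] => .seq (.push i false) (.pop i)
  | b :: l => .seq (pushWord i l) (.push i b)

end Prog

theorem run_clear (i : ℕ) (s : Store) :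
    Run (.clear i) s (Function.update s i []) (2 * (s i).length + 1) := by
  generalize h : s i = l
  induction l generalizing s with
  | nil => exact (Run.loop_nil h).congr (by rw [← h, Function.update_eq_self]) (by simp)
  | cons b l ih =>
    refine (Run.loop_cons (by simp [h]) (Run.pop i s) (ih _ (by simp [h]))).congr (by simp) ?_
    simp; omega

theorem run_move {i j : ℕ} (hij : i ≠ j) (s : Store) :
    Run (.move i j) s (Function.update (Function.update s i []) j ((s i).reverse ++ s j))
      (4 * (s i).length + 1) := by
  generalize h : s i = l
  induction l generalizing s with
  | nil =>
    refine (Run.loop_nil h).congr ?_ (by simp)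
    rw [← h, Function.update_eq_self]; simp [h]
  | cons b l ih =>
    have key : Run (.cases i (.pop i) (.seq (.pop i) (.push j false))
        (.seq (.pop i) (.push j true))) s
        (Function.update (Function.update s i l) j (b :: s j)) 3 := by
      cases b
      · exact (Run.cases_false h ((Run.pop _ _).seq (Run.push _ _ _))).congr
          (by simp [h, hij.symm]) le_rfl
      · exact (Run.cases_true h ((Run.pop _ _).seq (Run.push _ _ _))).congr
          (by simp [h, hij.symm]) le_rfl
    refine (Run.loop_cons (by simp [h]) key (ih _ (by simp [hij]))).congr ?_ ?_
    · ext1 m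
      simp only [Function.update_apply]
      split_ifs <;> simp_all
    · simp; omega

theorem run_fork {i j k : ℕ} (hij : i ≠ j) (hik : i ≠ k) (hjk : j ≠ k) (s : Store) :
    Run (.fork i j k) s (Function.update (Function.update (Function.update s i []) j
      ((s i).reverse ++ s j)) k ((s i).reverse ++ s k)) (5 * (s i).length + 1) := by
  generalize h : s i = l
  induction l generalizing s with
  | nil =>
    refine (Run.loop_nil h).congr ?_ (by simp)
    rw [← h, Function.update_eq_self]; simp [h]
  | cons b l ih =>
    have key : Run (.cases i (.pop i) (.seq (.pop i) (.seq (.push j false) (.push k false)))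
        (.seq (.pop i) (.seq (.push j true) (.push k true)))) s
        (Function.update (Function.update (Function.update s i l) j (b :: s j)) k (b :: s k)) 4 := by
      cases b
      · exact (Run.cases_false h ((Run.pop _ _).seq ((Run.push _ _ _).seq (Run.push _ _ _)))).congr
          (by simp [h, hij.symm, hik.symm, hjk.symm]) le_rfl
      · exact (Run.cases_true h ((Run.pop _ _).seq ((Run.push _ _ _).seq (Run.push _ _ _)))).congr
          (by simp [h, hij.symm, hik.symm, hjk.symm]) le_rfl
    refine (Run.loop_cons (by simp [h]) key (ih _ (by simp [hij, hik]))).congr ?_ ?_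
    · ext1 m
      simp only [Function.update_apply]
      split_ifs <;> simp_all
    · simp; omega

theorem run_pushWord (i : ℕ) (w : List Bool) (s : Store) :
    Run (.pushWord i w) s (Function.update s i (w ++ s i)) (w.length + 2) := by
  induction w with
  | nil => exact ((Run.push _ _ _).seq (Run.pop _ _)).congr (by simp) le_rfl
  | cons b l ih => exact (ih.seq (Run.push _ _ _)).congr (by simp) (by simp)

/-! ### Binary trees and their codes -/

/-- Binary trees, the universal data type of the programs. -/
inductive Bintree where
  | nil : Bintree
  | node : Bintree → Bintree → Bintree

/-- The prefix code of a tree. -/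
def Bintree.word : Bintree → List Bool
  | .nil => [false]
  | .node a b => true :: (a.word ++ b.word)

/-- The code is self-delimiting: a node announces exactly two further trees. Codes can therefore be
concatenated without separators, and equality reduces to a prefix test. -/
theorem Bintree.word_append_inj {a b : Bintree} {u v : List Bool}
    (h : a.word ++ u = b.word ++ v) : a = b ∧ u = v := by
  induction a generalizing b u v with
  | nil => cases b <;> simp_all [word]
  | node a₁ a₂ ih₁ ih₂ =>
    cases b with
    | nil => simp_all [word]
    | node b₁ b₂ =>
      simp only [word, List.cons_append, List.append_assoc, List.cons.injEq, true_and] at h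
      obtain ⟨h₁, h⟩ := ih₁ h
      obtain ⟨h₂, h⟩ := ih₂ h
      exact ⟨by rw [h₁, h₂], h⟩

/-- Types whose elements are represented by trees. -/
class Code (α : Type) where
  tree : α → Bintree
  inj : Function.Injective tree

/-- The word that represents an element. -/
def code {α : Type} [Code α] (a : α) : List Bool := (Code.tree a).word

/-- The size of an element is the length of its code. -/
def size {α : Type} [Code α] (a : α) : ℕ := (code a).length

instance : Code Bool where
  tree b := if b then .node .nil .nil else .nil
  inj := by intro a b; cases a <;> cases b <;> simp

instance {α β : Type} [Code α] [Code β] : Code (α × β) where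
  tree p := .node (Code.tree p.1) (Code.tree p.2)
  inj := by
    rintro ⟨a, b⟩ ⟨c, d⟩ h
    simp only [Bintree.node.injEq] at h
    rw [Code.inj h.1, Code.inj h.2]

/-- Lists are right combs. -/
def listTree {α : Type} [Code α] : List α → Bintree
  | [] => .nil
  | a :: l => .node (Code.tree a) (listTree l)

instance {α : Type} [Code α] : Code (List α) where
  tree := listTree
  inj := by
    intro l
    induction l with
    | nil => intro m h; cases m <;> simp_all [listTree]
    | cons a l ih =>
      intro m h
      cases m with
      | nil => simp_all [listTree]
      | cons b m =>
        simp only [listTree, Bintree.node.injEq] at h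
        rw [Code.inj h.1, ih h.2]

section code
variable {α β : Type} [Code α] [Code β]

theorem code_false : code false = [false] := rfl
theorem code_true : code true = [true, false, false] := rfl
theorem code_prod (p : α × β) : code p = true :: (code p.1 ++ code p.2) := rfl
theorem code_nil : code ([] : List α) = [false] := rfl
theorem code_cons (a : α) (l : List α) : code (a :: l) = true :: (code a ++ code l) := rfl

theorem code_append_inj {a b : α} {u v : List Bool} (h : code a ++ u = code b ++ v) :
    a = b ∧ u = v := by
  obtain ⟨h, h'⟩ := Bintree.word_append_inj h
  exact ⟨Code.inj h, h'⟩

theorem size_bool_le (b : Bool) : size b ≤ 3 := by cases b <;> simp [size, code_false, code_true]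
theorem size_prod (p : α × β) : size p = size p.1 + size p.2 + 1 := by
  simp [size, code_prod]
theorem size_nil : size ([] : List α) = 1 := rfl
theorem size_cons (a : α) (l : List α) : size (a :: l) = size a + size l + 1 := by
  simp [size, code_cons]
theorem length_le_size (l : List α) : l.length ≤ size l := by
  induction l with
  | nil => simp
  | cons a l ih => simp only [size_cons, List.length_cons]; omega
theorem size_mem_le {a : α} {l : List α} (h : a ∈ l) : size a ≤ size l := by
  induction l with
  | nil => simp at h
  | cons b l ih =>
    rw [size_cons]
    rcases List.mem_cons.1 h with rfl | h
    · omega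
    · have := ih h; omega
end code

/-! ### Functions computable in polynomial time by structured programs -/

theorem eval_mono (P : Polynomial ℕ) {m n : ℕ} (h : m ≤ n) : P.eval m ≤ P.eval n := by
  induction P using Polynomial.induction_on' with
  | add p q hp hq => simp only [Polynomial.eval_add]; omega
  | monomial d a => simp only [Polynomial.eval_monomial]; gcongr

/-- `f` is computed in polynomial time by a structured program, at every stack offset. -/
def PT {α β : Type} [Code α] [Code β] (f : α → β) : Prop :=
  ∃ P : Polynomial ℕ, ∀ n, ∃ c : Prog, ∀ (s : Store) (a : α),
    Run c (frame s n (code a) [] [] []) (frame s n (code (f a)) [] [] []) (P.eval (size a))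

section PT
variable {α β γ : Type} [Code α] [Code β] [Code γ]

theorem PT.size_le {f : α → β} (hf : PT f) :
    ∃ P : Polynomial ℕ, ∀ a, size (f a) ≤ P.eval (size a) := by
  obtain ⟨P, h⟩ := hf
  refine ⟨Polynomial.X + P, fun a => ?_⟩
  obtain ⟨c, hc⟩ := h 0
  simpa [size] using (hc (fun _ => []) a).length_le 0

theorem PT.id : PT (fun a : α => a) := by
  refine ⟨2, fun n => ⟨.seq (.push n false) (.pop n), fun s a => ?_⟩⟩
  exact ((Run.push _ _ _).seq (Run.pop _ _)).congr (by simp) (by simp)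

theorem PT.comp {g : β → γ} {f : α → β} (hg : PT g) (hf : PT f) : PT (fun a => g (f a)) := by
  obtain ⟨R, hR⟩ := hf.size_le
  obtain ⟨P, hf⟩ := hf
  obtain ⟨Q, hg⟩ := hg
  refine ⟨P + Q.comp R, fun n => ?_⟩
  obtain ⟨c, hc⟩ := hf n
  obtain ⟨d, hd⟩ := hg n
  refine ⟨.seq c d, fun s a => ((hc s a).seq (hd s (f a))).mono ?_⟩
  simp only [Polynomial.eval_add, Polynomial.eval_comp]
  have := eval_mono Q (hR a)
  omega

theorem PT.const (b : β) : PT (fun _ : α => b) := by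
  refine ⟨2 * Polynomial.X + Polynomial.C (size b + 3), fun n =>
    ⟨.seq (.clear n) (.pushWord n (code b)), fun s a => ?_⟩⟩
  refine ((run_clear _ _).seq (run_pushWord _ _ _)).congr (by simp) ?_
  simp [size]; omega

/-- The stack `n` is copied to the empty stack `n + 1`. -/
theorem run_copy_one (s : Store) (n : ℕ) (a : List Bool) :
    Run (.seq (.move n (n + 2)) (.fork (n + 2) n (n + 1))) (frame s n a [] [] [])
      (frame s n a a [] []) (9 * a.length + 2) := by
  refine ((run_move (by simp) _).seq (run_fork (by simp) (by simp) (by simp) _)).congr ?_ ?_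
  · simp
  · simp; omega

/-- The stack `n` is copied to the empty stack `n + 2`. -/
theorem run_copy_two (s : Store) (n : ℕ) (a b : List Bool) :
    Run (.seq (.move n (n + 3)) (.fork (n + 3) n (n + 2))) (frame s n a b [] [])
      (frame s n a b a []) (9 * a.length + 2) := by
  refine ((run_move (by simp) _).seq (run_fork (by simp) (by simp) (by simp) _)).congr ?_ ?_
  · simp
  · simp; omega

theorem PT.pair {f : α → β} {g : α → γ} (hf : PT f) (hg : PT g) : PT (fun a => (f a, g a)) := by
  obtain ⟨R, hR⟩ := hf.size_le
  obtain ⟨R', hR'⟩ := hg.size_le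
  obtain ⟨P, hf⟩ := hf
  obtain ⟨Q, hg⟩ := hg
  refine ⟨P + Q + 20 * Polynomial.X + 8 * R + 8 * R' + 10, fun n => ?_⟩
  obtain ⟨c, hc⟩ := hf (n + 1)
  obtain ⟨d, hd⟩ := hg (n + 2)
  -- `c` and `d` each consume a private copy of the input, at offsets `n + 1` and `n + 2`. A move
  -- reverses its word, so the results travel in two moves each.
  refine ⟨.seq (.seq (.move n (n + 2)) (.fork (n + 2) n (n + 1))) (.seq c
    (.seq (.seq (.move n (n + 3)) (.fork (n + 3) n (n + 2))) (.seq d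
    (.seq (.clear n) (.seq (.move (n + 2) (n + 3)) (.seq (.move (n + 3) n)
    (.seq (.move (n + 1) (n + 2)) (.seq (.move (n + 2) n) (.push n true))))))))), fun s a => ?_⟩
  have hc' := hc (frame s n (code a) [] [] []) a
  rw [← frame_shift_one, ← frame_shift_one] at hc'
  have hd' := hd (frame s n (code a) (code (f a)) [] []) a
  rw [← frame_shift_two, ← frame_shift_two] at hd'
  refine ((run_copy_one _ _ _).seq (hc'.seq ((run_copy_two _ _ _ _).seq (hd'.seq
    ((run_clear _ _).seq ((run_move (by simp) _).seq ((run_move (by simp) _).seq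
    ((run_move (by simp) _).seq ((run_move (by simp) _).seq (Run.push _ _ _)))))))))).congr ?_ ?_
  · simp [code_prod]
  · have h1 := hR a
    have h2 := hR' a
    simp [size] at *
    omega

/-- Move the first tree of the stack `n` to `n + 1`, reversing its code. -/
def Prog.split (n : ℕ) : Prog :=
  .seq (.push (n + 2) true) (.loop (n + 2) (.cases n (.pop (n + 2))
    (.seq (.pop n) (.seq (.push (n + 1) false) (.pop (n + 2))))
    (.seq (.pop n) (.seq (.push (n + 1) true) (.push (n + 2) true)))))

/-- The stack `n + 2` counts in unary the trees still to be read: a leaf removes a mark, a node adds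
one. The loop does not stop between subtrees, so the claim is put in continuation form, which lets
the two subtrees of a node be chained. -/
theorem run_split_loop (n : ℕ) (s : Store) (x : Bintree) (u v w d : List Bool) (s' : Store) (t : ℕ)
    (h : Run (.loop (n + 2) (.cases n (.pop (n + 2))
      (.seq (.pop n) (.seq (.push (n + 1) false) (.pop (n + 2))))
      (.seq (.pop n) (.seq (.push (n + 1) true) (.push (n + 2) true)))))
      (frame s n u (x.word.reverse ++ v) w d) s' t) :
    Run (.loop (n + 2) (.cases n (.pop (n + 2))
      (.seq (.pop n) (.seq (.push (n + 1) false) (.pop (n + 2))))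
      (.seq (.pop n) (.seq (.push (n + 1) true) (.push (n + 2) true)))))
      (frame s n (x.word ++ u) v (true :: w) d) s' (t + 5 * x.word.length) := by
  induction x generalizing u v w t with
  | nil =>
    refine (Run.loop_cons (t := 4) (t' := t) (by simp) (Run.cases_false (by simp [Bintree.word]; rfl)
      ((Run.pop _ _).seq ((Run.push _ _ _).seq (Run.pop _ _)))) ?_).mono (by simp [Bintree.word]; omega)
    simpa [Bintree.word] using h
  | node a b iha ihb =>
    refine (Run.loop_cons (t := 4) (t' := t + 5 * b.word.length + 5 * a.word.length) (by simp)
      (Run.cases_true (by simp [Bintree.word]; rfl)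
      ((Run.pop _ _).seq ((Run.push _ _ _).seq (Run.push _ _ _)))) ?_).mono
        (by simp [Bintree.word]; omega)
    have := iha (b.word ++ u) (true :: v) (true :: w) _ (ihb u _ w t (by
      simpa [Bintree.word] using h))
    simpa [Bintree.word] using this

theorem run_split (n : ℕ) (s : Store) (a : α) (u v d : List Bool) :
    Run (.split n) (frame s n (code a ++ u) v [] d)
      (frame s n u ((code a).reverse ++ v) [] d) (5 * size a + 2) := by
  have := run_split_loop n s (Code.tree a) u v [] d _ 1 (Run.loop_nil (by simp))
  refine (((Run.push _ _ _).congr (s'' := frame s n (code a ++ u) v [true] d) (by simp) le_rfl).seq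
    this).mono ?_
  rw [size, code]; omega

theorem PT.fst : PT (fun p : α × β => p.1) := by
  refine ⟨20 * Polynomial.X + 10, fun n => ⟨.seq (.pop n) (.seq (.split n) (.seq (.clear n)
    (.move (n + 1) n))), fun s p => ?_⟩⟩
  rw [code_prod]
  refine ((Run.pop _ _).seq ((by simpa using run_split n s p.1 (code p.2) [] [] : Run _ _ _ _).seq
    ((run_clear _ _).seq (run_move (by simp) _)))).congr ?_ ?_
  · simp
  · simp [size_prod]; simp [size]; omega

theorem PT.snd : PT (fun p : α × β => p.2) := by
  refine ⟨20 * Polynomial.X + 10, fun n => ⟨.seq (.pop n) (.seq (.split n) (.clear (n + 1))),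
    fun s p => ?_⟩⟩
  rw [code_prod]
  refine ((Run.pop _ _).seq ((by simpa using run_split n s p.1 (code p.2) [] [] : Run _ _ _ _).seq
    (run_clear _ _))).congr ?_ ?_
  · simp
  · simp [size_prod]; simp [size]; omega

theorem PT.head [Inhabited α] : PT (fun l : List α => l.headI) := by
  refine ⟨20 * Polynomial.X + Polynomial.C (size (default : α) + 10), fun n => ⟨.seq (.pop n)
    (.cases n (.pushWord n (code (default : α)))
    (.seq (.split n) (.seq (.clear n) (.move (n + 1) n)))
    (.seq (.split n) (.seq (.clear n) (.move (n + 1) n)))), fun s l => ?_⟩⟩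
  cases l with
  | nil =>
    refine ((Run.pop _ _).seq (Run.cases_nil (by simp [code_nil]) (run_pushWord _ _ _))).congr ?_ ?_
    · simp [code_nil]
    · simp [size]; omega
  | cons a l =>
    rw [code_cons]
    have key : Run (.seq (.split n) (.seq (.clear n) (.move (n + 1) n)))
      (frame s n (code a ++ code l) [] [] []) (frame s n (code a) [] [] [])
        (9 * size a + 2 * size l + 5) := by
      refine ((run_split n s a (code l) [] []).seq
        ((run_clear _ _).seq (run_move (by simp) _))).congr ?_ ?_
      · simp
      · simp [size]; omega
    cases hc : code a with
    | nil => cases ht : Code.tree a <;> simp [code, ht, Bintree.word] at hc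
    | cons b w =>
      rw [hc] at key
      cases b
      · refine ((Run.pop _ _).seq (Run.cases_false (l := w ++ code l) (by simp)
          (by simpa using key))).congr (by simp [hc]) (by simp [size_cons]; omega)
      · refine ((Run.pop _ _).seq (Run.cases_true (l := w ++ code l) (by simp)
          (by simpa using key))).congr (by simp [hc]) (by simp [size_cons]; omega)

theorem PT.cons {f : α → β} {g : α → List β} (hf : PT f) (hg : PT g) :
    PT (fun a => f a :: g a) := hf.pair hg

theorem PT.tail : PT (fun l : List α => l.tail) := by
  refine ⟨20 * Polynomial.X + 10, fun n => ⟨.cases n (.pop n) (.seq (.push n false) (.pop n))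
    (.seq (.pop n) (.seq (.split n) (.clear (n + 1)))), fun s l => ?_⟩⟩
  cases l with
  | nil =>
    exact (Run.cases_false (l := []) (by simp [code_nil]) ((Run.push _ _ _).seq (Run.pop _ _))).congr
      (by simp) (by simp)
  | cons a l =>
    rw [code_cons]
    refine (Run.cases_true (by simp; rfl) ((Run.pop _ _).seq
      ((by simpa using run_split n s a (code l) [] [] : Run _ _ _ _).seq (run_clear _ _)))).congr ?_ ?_
    · simp
    · simp [size_cons]; simp [size]; omega

theorem PT.ite {c : α → Bool} {f g : α → β} (hc : PT c) (hf : PT f) (hg : PT g) :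
    PT (fun a => if c a then f a else g a) := by
  obtain ⟨R, hp⟩ := hc.pair PT.id
  obtain ⟨P, hf⟩ := hf
  obtain ⟨Q, hg⟩ := hg
  refine ⟨R + P + Q + 5, fun n => ?_⟩
  obtain ⟨p, hp⟩ := hp n
  obtain ⟨d, hd⟩ := hf n
  obtain ⟨e, he⟩ := hg n
  refine ⟨.seq p (.seq (.pop n) (.cases n (.pop n) (.seq (.pop n) e)
    (.seq (.pop n) (.seq (.pop n) (.seq (.pop n) d))))), fun s a => ?_⟩
  have hp := hp s a
  simp only [code_prod] at hp
  cases h : c a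
  · refine (hp.seq ((Run.pop _ _).seq (Run.cases_false (l := code a) (by simp [h, code_false])
      (((Run.pop _ _).congr (s'' := frame s n (code a) [] [] []) (by simp [h, code_false])
        le_rfl).seq (he s a))))).congr (by simp [h]) ?_
    simp; omega
  · refine (hp.seq ((Run.pop _ _).seq (Run.cases_true (l := false :: false :: code a)
      (by simp [h, code_true]) ((Run.pop _ _).seq ((Run.pop _ _).seq (((Run.pop _ _).congr
        (s'' := frame s n (code a) [] [] []) (by simp [h, code_true]) le_rfl).seq
        (hd s a))))))).congr (by simp [h]) ?_
    simp; omega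

/-- Iterate `f` as long as the test `c` succeeds, starting from `i x`. -/
theorem PT.iterate {c : α → Bool} {f : α → α} {i : γ → α} (hc : PT c) (hf : PT f) (hi : PT i)
    (N : γ → ℕ) (P : Polynomial ℕ) (hN : ∀ x, N x ≤ P.eval (size x))
    (hs : ∀ x, ∀ j ≤ N x, size (f^[j] (i x)) ≤ P.eval (size x))
    (ht : ∀ x, ∀ j < N x, c (f^[j] (i x)) = true) (hlast : ∀ x, c (f^[N x] (i x)) = false) :
    PT (fun x => f^[N x] (i x)) := by
  obtain ⟨R, hp⟩ := hc.pair PT.id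
  obtain ⟨Q, hf⟩ := hf
  obtain ⟨I, hi⟩ := hi
  -- `T` bounds a single round. There are `N x + 1` rounds, the last being the failing test.
  let T : Polynomial ℕ := R.comp P + Q.comp P + 20
  refine ⟨I + (P + 1) * T + 2, fun n => ?_⟩
  obtain ⟨p, hp⟩ := hp n
  obtain ⟨d, hd⟩ := hf n
  obtain ⟨e, he⟩ := hi n
  -- The mark on `n + 1` keeps the loop alive. It is removed first because `p` and `d` expect empty
  -- scratch stacks, and restored only if the test succeeds.
  let body : Prog := .seq (.pop (n + 1)) (.seq p (.seq (.pop n) (.cases n (.pop n) (.pop n)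
    (.seq (.pop n) (.seq (.pop n) (.seq (.pop n) (.seq d (.push (n + 1) true))))))))
  refine ⟨.seq e (.seq (.push (n + 1) true) (.loop (n + 1) body)), fun s x => ?_⟩
  have hfalse : ∀ a : α, c a = false → Run body (frame s n (code a) [true] [] [])
      (frame s n (code a) [] [] []) (R.eval (size a) + 10) := by
    intro a ha
    have hp := hp s a
    simp only [code_prod, ha, code_false] at hp
    refine ((Run.pop _ _).seq (Run.seq (s' := _) (by simpa using hp) ((Run.pop _ _).seq
      (Run.cases_false (l := code a) (by simp) (Run.pop _ _))))).congr (by simp) (by omega)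
  have htrue : ∀ a : α, c a = true → Run body (frame s n (code a) [true] [] [])
      (frame s n (code (f a)) [true] [] []) (R.eval (size a) + Q.eval (size a) + 9) := by
    intro a ha
    have hp := hp s a
    simp only [code_prod, ha, code_true] at hp
    refine ((Run.pop _ _).seq (Run.seq (s' := _) (by simpa using hp) ((Run.pop _ _).seq
      (Run.cases_true (l := false :: false :: code a) (by simp)
        ((Run.pop _ _).seq ((Run.pop _ _).seq ((Run.pop _ _).seq (Run.seq
          (s' := frame s n (code (f a)) [] [] [])
        (by simpa using hd s a) (Run.push _ _ _))))))))).congr (by simp) (by omega)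
  have hR : ∀ j ≤ N x, R.eval (size (f^[j] (i x))) ≤ (R.comp P).eval (size x) := fun j hj => by
    rw [Polynomial.eval_comp]; exact eval_mono _ (hs x j hj)
  have hQ : ∀ j ≤ N x, Q.eval (size (f^[j] (i x))) ≤ (Q.comp P).eval (size x) := fun j hj => by
    rw [Polynomial.eval_comp]; exact eval_mono _ (hs x j hj)
  have hT : T.eval (size x) = (R.comp P).eval (size x) + (Q.comp P).eval (size x) + 20 := by
    simp [T]
  have main : ∀ m, m ≤ N x → Run (.loop (n + 1) body)
      (frame s n (code (f^[N x - m] (i x))) [true] [] [])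
      (frame s n (code (f^[N x] (i x))) [] [] []) ((m + 1) * T.eval (size x) + 1) := by
    intro m
    induction m with
    | zero =>
      intro _
      refine ((Run.loop_cons (by simp) (hfalse _ (hlast x)) (Run.loop_nil (by simp)))).mono ?_
      have := hR _ le_rfl
      omega
    | succ m ih =>
      intro hm
      have h1 : N x - m = N x - (m + 1) + 1 := by omega
      have ih := ih (by omega)
      rw [h1, Function.iterate_succ_apply'] at ih
      refine (Run.loop_cons (by simp) (htrue _ (ht x _ (by omega))) ih).mono ?_
      have h2 := hR (N x - (m + 1)) (by omega)
      have h3 := hQ (N x - (m + 1)) (by omega)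
      rw [add_mul (m + 1)]
      omega
  have := main (N x) le_rfl
  rw [Nat.sub_self] at this
  refine ((he s x).seq ((Run.push _ _ _).seq (by simpa using this))).mono ?_
  simp only [Polynomial.eval_add, Polynomial.eval_mul, Polynomial.eval_one, Polynomial.eval_ofNat]
  have := Nat.mul_le_mul_right (T.eval (size x)) (Nat.add_le_add_right (hN x) 1)
  omega

/-- Compare the stacks `n + 1` and `n`, leaving a mark on `n + 3` when they differ. -/
def Prog.compareLoop (n : ℕ) : Prog :=
  .loop (n + 1) (.cases (n + 1) (.pop (n + 1))
    (.seq (.pop (n + 1)) (.cases n (.push (n + 3) true) (.pop n)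
      (.seq (.pop n) (.push (n + 3) true))))
    (.seq (.pop (n + 1)) (.cases n (.push (n + 3) true)
      (.seq (.pop n) (.push (n + 3) true)) (.pop n))))

/-- Marks are only ever added, so they remember any mismatch. Exhausting `v` early counts as a
mismatch, but a remainder of `v` does not; hence a prefix relation. -/
theorem run_compareLoop (n : ℕ) (s : Store) (u v d : List Bool) :
    ∃ d', (d' = [] ↔ d = [] ∧ u <+: v) ∧ d'.length ≤ d.length + u.length ∧
      Run (.compareLoop n) (frame s n v u [] d) (frame s n (v.drop u.length) [] [] d')
        (6 * u.length + 1) := by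
  induction u generalizing v d with
  | nil => exact ⟨d, by simp, by simp, (Run.loop_nil (by simp)).congr (by simp) (by simp)⟩
  | cons b u ih =>
    cases v with
    | nil =>
      obtain ⟨d', h1, h2, h3⟩ := ih [] (true :: d)
      refine ⟨d', by simpa using h1, by simp at h2 ⊢; omega, ?_⟩
      have key : Run (.cases (n + 1) (.pop (n + 1))
          (.seq (.pop (n + 1)) (.cases n (.push (n + 3) true) (.pop n)
            (.seq (.pop n) (.push (n + 3) true))))
          (.seq (.pop (n + 1)) (.cases n (.push (n + 3) true)
            (.seq (.pop n) (.push (n + 3) true)) (.pop n))))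
          (frame s n [] (b :: u) [] d) (frame s n [] u [] (true :: d)) 4 := by
        cases b
        · exact (Run.cases_false (l := u) (by simp) ((Run.pop _ _).seq
            (Run.cases_nil (by simp) (Run.push _ _ _)))).congr (by simp) (by simp)
        · exact (Run.cases_true (l := u) (by simp) ((Run.pop _ _).seq
            (Run.cases_nil (by simp) (Run.push _ _ _)))).congr (by simp) (by simp)
      exact (Run.loop_cons (by simp) key h3).congr (by simp) (by simp; omega)
    | cons b' v =>
      obtain ⟨d', h1, h2, h3⟩ := ih v (if b = b' then d else true :: d)
      refine ⟨d', ?_, ?_, ?_⟩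
      · rw [h1]; split_ifs with h <;> simp [h, List.cons_prefix_cons]
      · refine h2.trans ?_
        split_ifs <;> (simp; try omega)
      have key : Run (.cases (n + 1) (.pop (n + 1))
          (.seq (.pop (n + 1)) (.cases n (.push (n + 3) true) (.pop n)
            (.seq (.pop n) (.push (n + 3) true))))
          (.seq (.pop (n + 1)) (.cases n (.push (n + 3) true)
            (.seq (.pop n) (.push (n + 3) true)) (.pop n))))
          (frame s n (b' :: v) (b :: u) [] d)
          (frame s n v u [] (if b = b' then d else true :: d)) 5 := by
        cases b <;> cases b'
        · exact (Run.cases_false (l := u) (by simp) ((Run.pop _ _).seq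
            (Run.cases_false (l := v) (by simp) (Run.pop _ _)))).congr (by simp) (by simp)
        · exact (Run.cases_false (l := u) (by simp) ((Run.pop _ _).seq
            (Run.cases_true (l := v) (by simp) ((Run.pop _ _).seq (Run.push _ _ _))))).congr
              (by simp) (by simp)
        · exact (Run.cases_true (l := u) (by simp) ((Run.pop _ _).seq
            (Run.cases_false (l := v) (by simp) ((Run.pop _ _).seq (Run.push _ _ _))))).congr
              (by simp) (by simp)
        · exact (Run.cases_true (l := u) (by simp) ((Run.pop _ _).seq
            (Run.cases_true (l := v) (by simp) (Run.pop _ _)))).congr (by simp) (by simp)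
      exact (Run.loop_cons (by simp) key h3).congr (by simp) (by simp; omega)

open Classical in
/-- Equality as a boolean function. -/
noncomputable def eqb {α : Type} (a b : α) : Bool := decide (a = b)

@[simp] theorem eqb_iff {α : Type} (a b : α) : eqb a b = true ↔ a = b := by simp [eqb]

theorem PT.eq_test : PT (fun p : α × α => eqb p.1 p.2) := by
  -- Splitting leaves the first code reversed on `n + 1`; three moves reverse it an odd number of
  -- times and bring it back there.
  refine ⟨40 * Polynomial.X + 40, fun n => ⟨.seq (.pop n) (.seq (.split n)
    (.seq (.move (n + 1) (n + 2)) (.seq (.move (n + 2) (n + 3)) (.seq (.move (n + 3) (n + 1))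
    (.seq (.compareLoop n) (.seq (.clear n) (.cases (n + 3)
      (.pushWord n (code true)) (.seq (.clear (n + 3)) (.pushWord n (code false)))
      (.seq (.clear (n + 3)) (.pushWord n (code false)))))))))), fun s p => ?_⟩⟩
  rw [code_prod]
  obtain ⟨d, h1, h2, h3⟩ := run_compareLoop n s (code p.1) (code p.2) []
  -- Between code words, being a prefix already forces equality.
  have hd : d = [] ↔ p.1 = p.2 := by
    rw [h1]
    constructor
    · rintro ⟨-, u, hu⟩
      exact (code_append_inj (u := u) (v := []) (by simpa using hu)).1
    · intro h; rw [h]; simp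
  have key : Run (.cases (n + 3) (.pushWord n (code true))
      (.seq (.clear (n + 3)) (.pushWord n (code false)))
      (.seq (.clear (n + 3)) (.pushWord n (code false)))) (frame s n [] [] [] d)
      (frame s n (code (eqb p.1 p.2)) [] [] []) (2 * d.length + 6) := by
    by_cases h : p.1 = p.2
    · rw [hd.2 h]
      exact (Run.cases_nil (by simp) (run_pushWord _ _ _)).congr (by simp [eqb, h]) (by simp [code_true])
    · cases d with
      | nil => exact absurd (hd.1 rfl) h
      | cons b d =>
        have := (run_clear (n + 3) (frame s n [] [] [] (b :: d))).seq
          (run_pushWord n (code false) _)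
        cases b
        · exact (Run.cases_false (l := d) (by simp) this).congr (by simp [eqb, h])
            (by simp [code_false])
        · exact (Run.cases_true (l := d) (by simp) this).congr (by simp [eqb, h])
            (by simp [code_false])
  refine ((Run.pop _ _).seq ((by simpa using run_split n s p.1 (code p.2) [] [] : Run _ _ _ _).seq
    ((run_move (by simp) _).seq ((run_move (by simp) _).seq ((run_move (by simp) _).seq
    (Run.seq (s' := _) (by simpa using h3) ((run_clear _ _).seq (by simpa using key)))))))).congr
    rfl ?_
  simp [size_prod]; simp [size] at *; omega

end PT

open Turing

/-! ### Compilation of structured programs to Turing machines -/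

namespace Prog

/-- The labels of a compiled program. -/
def Lab : Prog → Type
  | .push _ _ => Unit
  | .pop _ => Unit
  | .seq p q => p.Lab ⊕ q.Lab
  | .cases _ p q r => Option (p.Lab ⊕ q.Lab ⊕ r.Lab)
  | .loop _ p => Option p.Lab

/-- The label at which execution starts. -/
def entry : (p : Prog) → p.Lab
  | .push _ _ => ()
  | .pop _ => ()
  | .seq p _ => .inl p.entry
  | .cases _ _ _ _ => none
  | .loop _ _ => none

theorem finite_lab (p : Prog) : Finite p.Lab := by
  induction p with
  | push => exact inferInstanceAs (Finite Unit)
  | pop => exact inferInstanceAs (Finite Unit)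
  | seq p q hp hq => exact inferInstanceAs (Finite (p.Lab ⊕ q.Lab))
  | cases _ p q r hp hq hr => exact inferInstanceAs (Finite (Option (p.Lab ⊕ q.Lab ⊕ r.Lab)))
  | loop _ p hp => exact inferInstanceAs (Finite (Option p.Lab))

/-- All contents used by a program lie below its width. -/
def width : Prog → ℕ
  | .push k _ => k + 1
  | .pop k => k + 1
  | .seq p q => max p.width q.width
  | .cases k p q r => max (k + 1) (max p.width (max q.width r.width))
  | .loop k p => max (k + 1) p.width

end Prog

/-- The alphabets of the machine: an input stack over `A` and `N` contents of bits. -/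
abbrev StackAlphabet (A : Type) (N : ℕ) : Option (Fin N) → Type
  | none => A
  | some _ => Bool

/-- The internal state: the last symbol read from the input and the last bit inspected. -/
abbrev Register (A : Type) : Type := Option A × Option Bool

/-- The stack contents given by an input and a store. -/
def contents {A : Type} {N : ℕ} (w : List A) (s : Store) : ∀ k, List (StackAlphabet A N k)
  | none => w
  | some i => s i

theorem update_contents {A : Type} {N : ℕ} (w : List A) (s : Store) (i : Fin N) (x : List Bool) :
    Function.update (contents w s) (some i) x = contents w (Function.update s i x) := by
  funext k
  cases k with
  | none => simp [contents]
  | some j =>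
    by_cases h : j = i
    · subst h; simp [contents]
    · have : (j : ℕ) ≠ i := fun h' => h (Fin.ext h')
      simp [contents, h, this]

/-- The statement at a label of a compiled program; `emb` embeds the labels of the program into
those of the machine, and `exit` is the label at which execution is to continue. -/
def Prog.stmt {A Λ : Type} {N : ℕ} : (p : Prog) → p.width ≤ N → (p.Lab → Λ) → Λ → p.Lab →
    TM2.Stmt (StackAlphabet A N) Λ (Register A)
  | .push k b, h, _, exit, _ => .push (some ⟨k, h⟩) (fun _ => b) (.goto fun _ => exit)
  | .pop k, h, _, exit, _ => .pop (some ⟨k, h⟩) (fun v _ => v) (.goto fun _ => exit)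
  | .seq p q, h, emb, _, .inl l =>
      p.stmt ((le_max_left _ _).trans h) (fun l => emb (.inl l)) (emb (.inr q.entry)) l
  | .seq _ q, h, emb, exit, .inr l =>
      q.stmt ((le_max_right _ _).trans h) (fun l => emb (.inr l)) exit l
  | .cases k p q r, h, emb, _, none =>
      .peek (some ⟨k, (le_max_left _ _).trans h⟩) (fun v o => (v.1, o)) (.goto fun v =>
        match v.2 with
        | none => emb (some (.inl p.entry))
        | some false => emb (some (.inr (.inl q.entry)))
        | some true => emb (some (.inr (.inr r.entry))))
  | .cases k p q r, h, emb, exit, some (.inl l) =>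
      p.stmt (by simp only [width] at h; omega) (fun l => emb (some (.inl l))) exit l
  | .cases k p q r, h, emb, exit, some (.inr (.inl l)) =>
      q.stmt (by simp only [width] at h; omega) (fun l => emb (some (.inr (.inl l)))) exit l
  | .cases k p q r, h, emb, exit, some (.inr (.inr l)) =>
      r.stmt (by simp only [width] at h; omega) (fun l => emb (some (.inr (.inr l)))) exit l
  | .loop k p, h, emb, exit, none =>
      .peek (some ⟨k, (le_max_left _ _).trans h⟩) (fun v o => (v.1, o)) (.goto fun v =>
        match v.2 with
        | none => exit
        | some _ => emb (some p.entry))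
  | .loop k p, h, emb, _, some l =>
      p.stmt ((le_max_right _ _).trans h) (fun l => emb (some l)) (emb none) l

/-- The machine `M` leads from `c` to `c'` in at most `t` steps. -/
def Leads {A Λ : Type} {N : ℕ} (M : Λ → TM2.Stmt (StackAlphabet A N) Λ (Register A))
    (c c' : TM2.Cfg (StackAlphabet A N) Λ (Register A)) (t : ℕ) : Prop :=
  Nonempty (StateTransition.EvalsToInTime (TM2.step M) c (some c') t)

section Leads
variable {A Λ : Type} {N : ℕ} {M : Λ → TM2.Stmt (StackAlphabet A N) Λ (Register A)}

theorem Leads.trans {c c' c'' : TM2.Cfg (StackAlphabet A N) Λ (Register A)} {t t' : ℕ}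
    (h : Leads M c c' t) (h' : Leads M c' c'' t') : Leads M c c'' (t + t') := by
  obtain ⟨h⟩ := h
  obtain ⟨h'⟩ := h'
  exact ⟨add_comm t' t ▸ StateTransition.EvalsToInTime.trans _ _ _ _ _ _ h h'⟩

theorem Leads.mono {c c' : TM2.Cfg (StackAlphabet A N) Λ (Register A)} {t t' : ℕ}
    (h : Leads M c c' t) (ht : t ≤ t') : Leads M c c' t' := by
  obtain ⟨h⟩ := h
  exact ⟨⟨h.toEvalsTo, h.steps_le_m.trans ht⟩⟩

theorem Leads.single {l : Λ} {v : Register A} {S} {c' : TM2.Cfg (StackAlphabet A N) Λ (Register A)}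
    (h : TM2.stepAux (M l) v S = c') : Leads M ⟨some l, v, S⟩ c' 1 :=
  ⟨⟨⟨1, by subst h; rfl⟩, le_rfl⟩⟩

/-- Induction on the run, with `emb` and `exit` left general so that fragments can be placed
anywhere in a machine. Branching peeks before consulting the register, so its final value may stay
unspecified. -/
theorem Run.leads {p : Prog} {s s' : Store} {t : ℕ} (hr : Run p s s' t) :
    ∀ (h : p.width ≤ N) (emb : p.Lab → Λ) (exit : Λ), (∀ l, M (emb l) = p.stmt h emb exit l) →
    ∀ v w, ∃ v', Leads M ⟨some (emb p.entry), v, contents w s⟩ ⟨some exit, v', contents w s'⟩ t := by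
  induction hr with
  | push k b s =>
    intro h emb exit hM v w
    refine ⟨v, Leads.single ?_⟩
    rw [hM]
    simp [Prog.stmt, update_contents]
    rfl
  | pop k s =>
    intro h emb exit hM v w
    refine ⟨v, Leads.single ?_⟩
    rw [hM]
    simp [Prog.stmt, update_contents]
    rfl
  | @seq p q s s' s'' t t' _ _ ihp ihq =>
    intro h emb exit hM v w
    obtain ⟨v', h1⟩ := ihp ((le_max_left _ _).trans h) (fun l => emb (.inl l))
      (emb (.inr q.entry)) (fun l => hM (.inl l)) v w
    obtain ⟨v'', h2⟩ := ihq ((le_max_right _ _).trans h) (fun l => emb (.inr l)) exit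
      (fun l => hM (.inr l)) v' w
    exact ⟨v'', h1.trans h2⟩
  | @cases_nil k p q r s s' t hs _ ih =>
    intro h emb exit hM v w
    obtain ⟨v', h1⟩ := ih (by simp only [Prog.width] at h; omega)
      (fun l => emb (some (.inl l))) exit (fun l => hM (some (.inl l))) (v.1, none) w
    refine ⟨v', ((Leads.single ?_).trans h1).mono (add_comm _ _).le⟩
    rw [hM]
    simp [Prog.entry, Prog.stmt, contents, hs]
  | @cases_false k p q r s s' t l hs _ ih =>
    intro h emb exit hM v w
    obtain ⟨v', h1⟩ := ih (by simp only [Prog.width] at h; omega)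
      (fun l => emb (some (.inr (.inl l)))) exit (fun l => hM (some (.inr (.inl l))))
      (v.1, some false) w
    refine ⟨v', ((Leads.single ?_).trans h1).mono (add_comm _ _).le⟩
    rw [hM]
    simp [Prog.entry, Prog.stmt, contents, hs]
  | @cases_true k p q r s s' t l hs _ ih =>
    intro h emb exit hM v w
    obtain ⟨v', h1⟩ := ih (by simp only [Prog.width] at h; omega)
      (fun l => emb (some (.inr (.inr l)))) exit (fun l => hM (some (.inr (.inr l))))
      (v.1, some true) w
    refine ⟨v', ((Leads.single ?_).trans h1).mono (add_comm _ _).le⟩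
    rw [hM]
    simp [Prog.entry, Prog.stmt, contents, hs]
  | @loop_nil k p s hs =>
    intro h emb exit hM v w
    refine ⟨(v.1, none), Leads.single ?_⟩
    rw [hM]
    simp [Prog.entry, Prog.stmt, contents, hs]
  | @loop_cons k p s s' s'' t t' hs _ _ ih ih' =>
    intro h emb exit hM v w
    obtain ⟨b, l, hbl⟩ := List.exists_cons_of_ne_nil hs
    obtain ⟨v', h1⟩ := ih ((le_max_right _ _).trans h) (fun l => emb (some l)) (emb none)
      (fun l => hM (some l)) (v.1, some b) w
    obtain ⟨v'', h2⟩ := ih' h emb exit hM v' w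
    refine ⟨v'', ((Leads.single ?_).trans (h1.trans h2)).mono (add_comm _ _).le⟩
    rw [hM]
    simp [Prog.entry, Prog.stmt, contents, hbl]
  | mono _ ht ih =>
    intro h emb exit hM v w
    obtain ⟨v', h1⟩ := ih h emb exit hM v w
    exact ⟨v', h1.mono ht⟩

end Leads

/-- The labels of the machine that reads its input and then runs a program. -/
inductive MachineLab (A : Type) (p : Prog) where
  | start
  | read
  | store (a : A)
  | run (l : p.Lab)
  | finish

theorem MachineLab.finite {A : Type} [Finite A] (p : Prog) : Finite (MachineLab A p) := by
  have := p.finite_lab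
  let f : MachineLab A p → Option (Option (Option (A ⊕ p.Lab)))
    | .start => none
    | .read => some none
    | .finish => some (some none)
    | .store a => some (some (some (.inl a)))
    | .run l => some (some (some (.inr l)))
  refine Finite.of_injective f ?_
  intro x y h
  cases x <;> cases y <;> simp_all [f]

/-- Push a word and continue with `q`. -/
def pushStmt {A Λ : Type} {N : ℕ} (i : Fin N) (u : List Bool)
    (q : TM2.Stmt (StackAlphabet A N) Λ (Register A)) :
    TM2.Stmt (StackAlphabet A N) Λ (Register A) :=
  u.foldl (fun q b => .push (some i) (fun _ => b) q) q

theorem stepAux_pushStmt {A Λ : Type} {N : ℕ} (i : Fin N) (u : List Bool)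
    (q : TM2.Stmt (StackAlphabet A N) Λ (Register A)) (v : Register A) (w : List A) (s : Store) :
    TM2.stepAux (pushStmt i u q) v (contents w s) =
      TM2.stepAux q v (contents w (Function.update s i (u ++ s i))) := by
  induction u generalizing q with
  | nil => simp [pushStmt]
  | cons b u ih =>
    rw [pushStmt, List.foldl_cons, ← pushStmt, ih]
    rw [TM2.stepAux, update_contents]
    simp [contents]

/-- The machine that reads its input `w`, puts the code of the reversal of `w` on the first stack
of bits, and then runs the program `p`. -/
def machineStmt {A : Type} [Code A] (p : Prog) :
    MachineLab A p → TM2.Stmt (StackAlphabet A (p.width + 1)) (MachineLab A p) (Register A)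
  | .start => .push (some 0) (fun _ => false) (.goto fun _ => .read)
  | .read => .pop none (fun _ o => (o, none)) (.goto fun v =>
      match v.1 with
      | none => .run p.entry
      | some a => .store a)
  | .store a => pushStmt 0 (true :: code a) (.goto fun _ => .read)
  | .run l => p.stmt (Nat.le_succ _) .run .finish l
  | .finish => .load (fun _ => (none, none)) .halt

/-- Consing onto a list merely prepends `true :: code a` to its code, so a symbol costs two steps:
one to read it and one to store it. The first symbol ends up deepest, which causes the reversal. -/
theorem leads_read {A : Type} [Code A] (p : Prog) (w l : List A) (v : Register A) (s : Store) :
    Leads (machineStmt p) ⟨some .read, v, contents w (frame s 0 (code l) [] [] [])⟩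
      ⟨some (.run p.entry), (none, none), contents [] (frame s 0 (code (w.reverse ++ l)) [] [] [])⟩
      (2 * w.length + 1) := by
  induction w generalizing l v with
  | nil =>
    refine Leads.single ?_
    simp [machineStmt]
    simp [contents]
  | cons a w ih =>
    have h1 : Leads (machineStmt p)
        ⟨some .read, v, contents (a :: w) (frame s 0 (code l) [] [] [])⟩
        ⟨some (.store a), (some a, none), contents w (frame s 0 (code l) [] [] [])⟩ 1 := by
      refine Leads.single ?_
      simp [machineStmt]
      simp [contents]
      funext k
      cases k <;> simp [contents]
    have h2 : Leads (machineStmt p)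
        ⟨some (.store a), (some a, none), contents w (frame s 0 (code l) [] [] [])⟩
        ⟨some .read, (some a, none), contents w (frame s 0 (code (a :: l)) [] [] [])⟩ 1 := by
      refine Leads.single ?_
      rw [machineStmt, stepAux_pushStmt]
      simp [code_cons]
    have h3 := (h1.trans h2).trans (ih (a :: l) (some a, none))
    rw [List.reverse_cons, List.append_assoc]
    exact h3.mono (by simp; omega)

/-- A program with boolean output, finished by a conversion of the output into a single bit. -/
theorem run_output (b : Bool) (s : Store) :
    Run (.cases 0 (.pop 0) (.seq (.pop 0) (.push 0 false))
      (.seq (.pop 0) (.seq (.pop 0) (.seq (.pop 0) (.push 0 true)))))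
      (frame s 0 (code b) [] [] []) (frame s 0 [b] [] [] []) 5 := by
  cases b
  · exact (Run.cases_false (l := []) (by simp [code_false])
      ((Run.pop _ _).seq (Run.push _ _ _))).congr (by simp [code_false]) (by simp)
  · exact (Run.cases_true (l := [false, false]) (by simp [code_true]) ((Run.pop _ _).seq
      ((Run.pop _ _).seq ((Run.pop _ _).seq (Run.push _ _ _))))).congr
        (by simp [code_true]) (by simp)

theorem exists_size_le {A : Type} [Finite A] [Code A] :
    ∃ C, ∀ l : List A, size l ≤ C * l.length + 1 := by
  obtain ⟨C, hC⟩ := (Set.finite_range (fun a : A => size a)).bddAbove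
  refine ⟨C + 1, fun l => ?_⟩
  induction l with
  | nil => simp [size_nil]
  | cons a l ih =>
    have : size a ≤ C := hC ⟨a, rfl⟩
    rw [size_cons, List.length_cons, mul_add]
    omega

/-- A language is in `P` if a structured program decides it in polynomial time, working on the
reversals of the words. -/
theorem inP_of_pt {A : Type} [Finite A] [Code A] {L : Set (List A)} {f : List A → Bool}
    (hf : PT f) (hL : ∀ w, f w.reverse = true ↔ w ∈ L) : InP L := by
  obtain ⟨P, hP⟩ := hf
  obtain ⟨c, hc⟩ := hP 0
  obtain ⟨C, hC⟩ := exists_size_le (A := A)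
  let p : Prog := .seq c (.cases 0 (.pop 0) (.seq (.pop 0) (.push 0 false))
      (.seq (.pop 0) (.seq (.pop 0) (.seq (.pop 0) (.push 0 true)))))
  have hfin := MachineLab.finite (A := A) p
  let : Fintype A := Fintype.ofFinite A
  let : Fintype (MachineLab A p) := Fintype.ofFinite _
  let tm : FinTM2 :=
    { K := Option (Fin (p.width + 1))
      k₀ := none
      k₁ := some 0
      Γ := StackAlphabet A (p.width + 1)
      Λ := MachineLab A p
      main := .start
      σ := Register A
      initialState := (none, none)
      Γk₀Fin := inferInstanceAs (Fintype A)
      m := machineStmt p }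
  let T : Polynomial ℕ := P.comp (Polynomial.C C * Polynomial.X + 1) + 2 * Polynomial.X + 10
  refine ⟨fun w => f w.reverse, hL, ⟨⟨tm, Equiv.refl A, Equiv.refl Bool⟩, T, fun w => ?_⟩, ?_⟩
  · refine Classical.choice ?_
    have h1 : Leads (machineStmt p) ⟨some .start, (none, none), contents w (fun _ => [])⟩
        ⟨some .read, (none, none), contents w (frame (fun _ => []) 0 (code ([] : List A)) [] [] [])⟩
        1 := by
      refine Leads.single ?_
      rw [machineStmt, TM2.stepAux, update_contents]
      simp [contents, code_nil]
      congr 1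
      ext1 m
      by_cases h : m = 0
      · subst h; simp
      · simp [h, frame]
    have h2 := leads_read p w ([] : List A) (none, none) (fun _ => [])
    obtain ⟨v, h3⟩ := ((hc (fun _ => []) (w.reverse ++ [])).seq (run_output _ _)).leads
      (M := machineStmt (A := A) p) (p := p) (Nat.le_succ _) .run .finish (fun _ => rfl) (none, none) []
    -- A halting configuration must carry the initial state, so the last step resets the register.
    have h4 : Leads (machineStmt p) ⟨some .finish, v, contents [] (frame (fun _ => []) 0
        [f (w.reverse ++ [])] [] [] [])⟩ ⟨none, (none, none), contents [] (frame (fun _ => []) 0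
        [f (w.reverse ++ [])] [] [] [])⟩ 1 := Leads.single rfl
    have h5 : Leads (machineStmt (A := A) p) _ _ (T.eval w.length) :=
      (((h1.trans h2).trans h3).trans h4).mono (by
        have h6 := eval_mono P (hC (w.reverse ++ []))
        have h7 : T.eval w.length = P.eval (C * w.length + 1) + 2 * w.length + 10 := by simp [T]
        simp only [List.length_append, List.length_reverse, List.length_nil, Nat.add_zero] at h6
        omega)
    have hinit : initList tm (w.map (Equiv.refl A).invFun) =
        ⟨some .start, (none, none), contents w (fun _ => [])⟩ := by
      simp only [initList, tm]
      congr 1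
      funext k
      cases k <;> simp [contents]
    have hhalt : haltList tm ((Computability.encodeBool (f w.reverse)).map (Equiv.refl Bool).invFun) =
        ⟨none, (none, none), contents [] (frame (fun _ => []) 0
        [f (w.reverse ++ [])] [] [] [])⟩ := by
      simp only [haltList, tm]
      congr 1
      funext k
      rcases k with _ | ⟨i, hi⟩
      · simp [contents]
      · by_cases h : i = 0
        · subst h
          simp [contents, Computability.encodeBool]
        · simp [contents, h, frame, Fin.ext_iff]
    obtain ⟨h5⟩ := h5
    change Nonempty (StateTransition.EvalsToInTime tm.step
      (initList tm (w.map (Equiv.refl A).invFun)) (some (haltList tm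
        ((Computability.encodeBool (f w.reverse)).map (Equiv.refl Bool).invFun)))
      (T.eval w.length))
    rw [hinit, hhalt]
    exact ⟨h5⟩
  · intro k
    cases k with
    | none => exact inferInstanceAs (Finite A)
    | some i => exact inferInstanceAs (Finite Bool)

/-! ### Derived polynomial-time combinators -/

section combinators
variable {α β γ δ : Type} [Code α] [Code β] [Code γ] [Code δ]

theorem PT.left {f : γ → α × β} (h : PT f) : PT (fun x => (f x).1) := PT.fst.comp h
theorem PT.right {f : γ → α × β} (h : PT f) : PT (fun x => (f x).2) := PT.snd.comp h

theorem PT.eqb {f g : γ → α} (hf : PT f) (hg : PT g) : PT (fun x => eqb (f x) (g x)) :=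
  PT.eq_test.comp (hf.pair hg)

theorem PT.not {f : γ → Bool} (hf : PT f) : PT (fun x => !f x) := by
  have h : (fun x => !f x) = fun x => if f x = true then false else true := by
    funext x; cases f x <;> rfl
  rw [h]
  exact hf.ite (PT.const _) (PT.const _)

theorem PT.and {f g : γ → Bool} (hf : PT f) (hg : PT g) : PT (fun x => f x && g x) := by
  have h : (fun x => f x && g x) = fun x => if f x = true then g x else false := by
    funext x; cases f x <;> rfl
  rw [h]
  exact hf.ite hg (PT.const _)

theorem PT.or {f g : γ → Bool} (hf : PT f) (hg : PT g) : PT (fun x => f x || g x) := by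
  have h : (fun x => f x || g x) = fun x => if f x = true then true else g x := by
    funext x; cases f x <;> rfl
  rw [h]
  exact hf.ite (PT.const _) hg

/-- Case distinction on an element of a finite type. -/
theorem PT.finite_cases {A : Type} [Finite A] [Inhabited A] [Code A] {f : A → γ → β}
    (h : ∀ a, PT (f a)) : PT (fun p : A × γ => f p.1 p.2) := by
  have := Fintype.ofFinite A
  have key : ∀ L : List A, ∃ g : A × γ → β, PT g ∧ ∀ a ∈ L, ∀ x, g (a, x) = f a x := by
    intro L
    induction L with
    | nil => exact ⟨fun p => f default p.2, (h default).comp PT.snd, by simp⟩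
    | cons a L ih =>
      obtain ⟨g, hg, hL⟩ := ih
      refine ⟨fun p => if CQA.eqb p.1 a = true then f a p.2 else g p,
        (PT.fst.eqb (PT.const a)).ite ((h a).comp PT.snd) hg, ?_⟩
      intro b hb x
      by_cases hba : b = a
      · subst hba; simp
      · simp [hba, hL b (by simpa [hba] using hb)]
  obtain ⟨g, hg, hL⟩ := key Finset.univ.toList
  convert hg using 1
  funext p
  exact (hL p.1 (by simp) p.2).symm

theorem size_foldl_le {α β : Type} [Code β] {g : β → α → β} {l : List α} {C : ℕ}
    (h : ∀ b, ∀ a ∈ l, size (g b a) ≤ size b + C) (b : β) :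
    size (l.foldl g b) ≤ size b + l.length * C := by
  induction l generalizing b with
  | nil => simp
  | cons a l ih =>
    have h1 := ih (fun b a ha => h b a (List.mem_cons_of_mem _ ha)) (g b a)
    have h2 := h b a List.mem_cons_self
    rw [List.foldl_cons, List.length_cons, Nat.succ_mul]
    omega

/-- Folding over a list is polynomial when every step increases the size of the accumulator by at
most a polynomial in the size of the context. -/
theorem PT.foldl [Inhabited α] {l : γ → List α} {i : γ → β} {g : γ → β → α → β}
    (hl : PT l) (hi : PT i) (hg : PT (fun p : γ × β × α => g p.1 p.2.1 p.2.2))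
    (C : Polynomial ℕ)
    (hC : ∀ x b, ∀ a ∈ l x, size (g x b a) ≤ size b + C.eval (size x)) :
    PT (fun x => (l x).foldl (g x) (i x)) := by
  obtain ⟨I, hI⟩ := hi.size_le
  obtain ⟨R, hR⟩ := hl.size_le
  let step : γ × β × List α → γ × β × List α := fun p =>
    (p.1, g p.1 p.2.1 p.2.2.headI, p.2.2.tail)
  have hstep : PT step := PT.fst.pair ((hg.comp (PT.fst.pair ((PT.left PT.snd).pair
    (PT.head.comp (PT.right PT.snd))))).pair (PT.tail.comp (PT.right PT.snd)))
  have htest : PT (fun p : γ × β × List α => !CQA.eqb p.2.2 []) :=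
    PT.not (PT.eqb (PT.right PT.snd) (PT.const _))
  have hstart : PT (fun x => (x, i x, l x)) := PT.id.pair (hi.pair hl)
  have hiter : ∀ x, ∀ m : List α, ∀ b, ∀ j ≤ m.length,
      step^[j] (x, b, m) = (x, (m.take j).foldl (g x) b, m.drop j) := by
    intro x m
    induction m with
    | nil => intro b j hj; obtain rfl : j = 0 := by simpa using hj
             rfl
    | cons a m ih =>
      intro b j hj
      cases j with
      | zero => rfl
      | succ j =>
        rw [Function.iterate_succ_apply]
        exact ih _ j (by simpa using hj)
  have hit := fun x => hiter x (l x) (i x)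
  have hlen : ∀ x, (l x).length ≤ R.eval (size x) := fun x => (length_le_size _).trans (hR x)
  -- The summands bound the context, the initial accumulator, its growth over at most `R` steps, and
  -- the remaining list; `2` pays for the two pairings.
  have main := PT.iterate htest hstep hstart (fun x => (l x).length)
    (Polynomial.X + I + R * C + R + 2) ?_ ?_ ?_ ?_
  · have := main.right.left
    convert this using 2 with x
    rw [hit x _ le_rfl, List.take_length]
  · intro x
    have := hlen x
    simp
    omega
  · intro x j hj
    rw [hit x j hj]
    have h1 : size ((l x).drop j) ≤ size (l x) := by
      generalize l x = m
      clear hj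
      induction m generalizing j with
      | nil => simp
      | cons a m ih =>
        cases j with
        | zero => simp
        | succ j => rw [List.drop_succ_cons, size_cons]; have := ih j; omega
    have h2 := size_foldl_le (g := g x) (l := (l x).take j) (C := C.eval (size x))
      (fun b a ha => hC x b a (List.mem_of_mem_take ha)) (i x)
    have h3 : ((l x).take j).length * C.eval (size x) ≤ R.eval (size x) * C.eval (size x) :=
      Nat.mul_le_mul_right _ (by have := hlen x; simp; omega)
    have h4 := hI x
    have h5 := hR x
    simp only [size_prod, Polynomial.eval_add, Polynomial.eval_mul, Polynomial.eval_X,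
      Polynomial.eval_ofNat]
    omega
  · intro x j hj
    rw [hit x j hj.le]
    have : (l x).drop j ≠ [] := by simp; omega
    simp [CQA.eqb, this]
  · intro x
    rw [hit x _ le_rfl]
    simp

theorem PT.any [Inhabited α] {l : γ → List α} {p : γ → α → Bool} (hl : PT l)
    (hp : PT (fun q : γ × α => p q.1 q.2)) : PT (fun x => (l x).any (p x)) := by
  have h : ∀ x, (l x).any (p x) = (l x).foldl (fun b a => p x a || b) false := by
    intro x
    have : ∀ b, (l x).foldl (fun b a => p x a || b) b = ((l x).any (p x) || b) := by
      induction l x with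
      | nil => simp
      | cons a m ih => intro b; simp [ih]; cases p x a <;> simp
    rw [this, Bool.or_false]
  simp only [h]
  refine PT.foldl hl (PT.const false) (PT.or (hp.comp (PT.fst.pair (PT.right PT.snd)))
    (PT.left PT.snd)) 3 (fun x b a _ => ?_)
  have := size_bool_le (p x a || b)
  simp
  omega

theorem PT.all [Inhabited α] {l : γ → List α} {p : γ → α → Bool} (hl : PT l)
    (hp : PT (fun q : γ × α => p q.1 q.2)) : PT (fun x => (l x).all (p x)) := by
  simp only [List.all_eq_not_any_not]
  exact (PT.any hl hp.not).not

/-- Membership as a boolean function. -/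
noncomputable def memb {α : Type} (a : α) (l : List α) : Bool := l.any (fun b => CQA.eqb a b)

@[simp] theorem memb_iff {α : Type} (a : α) (l : List α) : memb a l = true ↔ a ∈ l := by
  simp [memb]

theorem PT.memb [Inhabited α] {f : γ → α} {l : γ → List α} (hf : PT f) (hl : PT l) :
    PT (fun x => memb (f x) (l x)) :=
  PT.any (p := fun x b => CQA.eqb (f x) b) hl ((hf.comp PT.fst).eqb PT.snd)

end combinators

/-! ### The graph algorithm -/

section algorithm
variable {V : Type}

/-- Add the head of the edge `e` if its tail has been reached and `e` avoids `I`. -/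
noncomputable def extend (I acc : List V) (e : V × V) : List V :=
  if (memb e.1 acc && (!memb e.1 I && !memb e.2 I)) = true then e.2 :: acc else acc

/-- The vertices that can be reached from `v` through edges of `E` that avoid `I`. -/
noncomputable def reach (E : List (V × V)) (I : List V) (v : V) : List V :=
  E.foldl (fun acc _ => E.foldl (extend I) acc) [v]

/-- Some walk with `j` edges starts in `cur` and passes the final test `P`, which is given the edge
list, a vertex `a`, the end of the walk, and the preceding vertices of the walk added to `I`. -/
noncomputable def walkTest (P : List (V × V) × V × V × List V → Bool) :
    ℕ → List (V × V) × V × V × List V → Bool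
  | 0, x => P x
  | j + 1, x => x.1.any fun e =>
      eqb e.1 x.2.2.1 && walkTest P j (x.1, x.2.1, e.2, x.2.2.1 :: x.2.2.2)

/-- The edge `e` lies on a closed walk of length `k`. -/
noncomputable def onCycle (k : ℕ) (E : List (V × V)) (e : V × V) : Bool :=
  walkTest (fun x => eqb x.2.2.1 x.2.1) (k - 1) (E, e.1, e.2, [])

/-- The edge `e` is the first edge of a walk of length `k` that does not return to its start, but
that can be closed without visiting its inner vertices again. -/
noncomputable def onLongCycle (k : ℕ) (E : List (V × V)) (e : V × V) : Bool :=
  walkTest (fun x => !eqb x.2.2.1 x.2.1 && memb x.2.1 (reach x.1 x.2.2.2 x.2.2.1)) (k - 1)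
    (E, e.1, e.2, [])

/-- Some edge leads only to edges that lie on cycles of length `k`, and on no longer cycles. -/
noncomputable def certainGraph (k : ℕ) (E : List (V × V)) : Bool :=
  E.any fun e => E.all fun e' =>
    !memb e'.1 (reach E [] e.1) || (onCycle k E e' && !onLongCycle k E e')

variable [Code V] [Inhabited V]

theorem size_extend_le {V : Type} [Code V] (I acc : List V) (e : V × V) :
    size (extend I acc e) ≤ size acc + size e := by
  unfold extend
  split_ifs
  · rw [size_cons, size_prod]; omega
  · omega

theorem PT.extend : PT (fun q : (List V × List V) × (V × V) => extend q.1.1 q.1.2 q.2) := by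
  have hI : PT (fun q : (List V × List V) × (V × V) => q.1.1) := PT.left PT.fst
  have ha : PT (fun q : (List V × List V) × (V × V) => q.1.2) := PT.right PT.fst
  have h1 : PT (fun q : (List V × List V) × (V × V) => q.2.1) := PT.left PT.snd
  have h2 : PT (fun q : (List V × List V) × (V × V) => q.2.2) := PT.right PT.snd
  exact ((h1.memb ha).and ((h1.memb hI).not.and (h2.memb hI).not)).ite (h2.cons ha) ha

theorem PT.reach : PT (fun x : List (V × V) × List V × V => reach x.1 x.2.1 x.2.2) := by
  have hinner : PT (fun q : (List (V × V) × List V × V) × List V × (V × V) =>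
      q.1.1.foldl (CQA.extend q.1.2.1) q.2.1) := by
    refine PT.foldl (l := fun q : (List (V × V) × List V × V) × List V × (V × V) => q.1.1)
      (i := fun q => q.2.1) (g := fun q acc e => CQA.extend q.1.2.1 acc e)
      (PT.left PT.fst) (PT.left PT.snd) ?_ Polynomial.X ?_
    · exact PT.extend.comp (((PT.left (PT.right (PT.left PT.fst))).pair (PT.left PT.snd)).pair
        (PT.right PT.snd))
    · intro x b a ha
      have h1 := size_extend_le x.1.2.1 b a
      have h2 := size_mem_le ha
      simp only [size_prod] at *
      simp only [Polynomial.eval_X]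
      omega
  -- A pass adds at most one vertex per edge, so it grows the accumulator by at most the square of
  -- the input size. The growth is additive and thus stays polynomial over all passes.
  refine PT.foldl (i := fun x : List (V × V) × List V × V => [x.2.2])
    (g := fun x acc _ => x.1.foldl (CQA.extend x.2.1) acc) PT.fst
    (PT.cons (PT.right PT.snd) (PT.const [])) hinner (Polynomial.X * Polynomial.X) ?_
  intro x b _ _
  refine (size_foldl_le (C := size x) (fun b a ha => ?_) b).trans ?_
  · have h1 := size_extend_le x.2.1 b a
    have h2 := size_mem_le ha
    simp only [size_prod] at *
    omega
  · have h1 := length_le_size x.1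
    have h2 : x.1.length ≤ size x := by simp only [size_prod]; omega
    have h3 := Nat.mul_le_mul_right (size x) h2
    simp only [Polynomial.eval_mul, Polynomial.eval_X]
    omega

/-- Here `j` is a constant and not part of the input: the test is `j` nested searches of the edge
list, and the polynomial may depend on `j`. -/
theorem PT.walkTest {P : List (V × V) × V × V × List V → Bool} (hP : PT P) (j : ℕ) :
    PT (walkTest P j) := by
  induction j with
  | zero => exact hP
  | succ j ih =>
    refine PT.any (l := fun x : List (V × V) × V × V × List V => x.1)
      (p := fun x e => CQA.eqb e.1 x.2.2.1 && CQA.walkTest P j (x.1, x.2.1, e.2, x.2.2.1 :: x.2.2.2))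
      PT.fst ?_
    have hE : PT (fun q : (List (V × V) × V × V × List V) × (V × V) => q.1.1) := PT.left PT.fst
    have ha : PT (fun q : (List (V × V) × V × V × List V) × (V × V) => q.1.2.1) :=
      PT.left (PT.right PT.fst)
    have hc : PT (fun q : (List (V × V) × V × V × List V) × (V × V) => q.1.2.2.1) :=
      PT.left (PT.right (PT.right PT.fst))
    have hI : PT (fun q : (List (V × V) × V × V × List V) × (V × V) => q.1.2.2.2) :=
      PT.right (PT.right (PT.right PT.fst))
    exact PT.and (PT.eqb (PT.left PT.snd) hc)
      (ih.comp (hE.pair (ha.pair ((PT.right PT.snd).pair (hc.cons hI)))))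

theorem PT.onCycle (k : ℕ) : PT (fun x : List (V × V) × (V × V) => onCycle k x.1 x.2) := by
  refine (PT.walkTest (P := fun x => CQA.eqb x.2.2.1 x.2.1) ?_ (k - 1)).comp
    (PT.fst.pair ((PT.left PT.snd).pair ((PT.right PT.snd).pair (PT.const []))))
  exact PT.eqb (PT.left (PT.right PT.snd)) (PT.left PT.snd)

theorem PT.onLongCycle (k : ℕ) :
    PT (fun x : List (V × V) × (V × V) => onLongCycle k x.1 x.2) := by
  refine (PT.walkTest (P := fun x => !CQA.eqb x.2.2.1 x.2.1 &&
    CQA.memb x.2.1 (CQA.reach x.1 x.2.2.2 x.2.2.1)) ?_ (k - 1)).comp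
    (PT.fst.pair ((PT.left PT.snd).pair ((PT.right PT.snd).pair (PT.const []))))
  have hc : PT (fun x : List (V × V) × V × V × List V => x.2.2.1) := PT.left (PT.right PT.snd)
  exact PT.and (PT.not (PT.eqb hc (PT.left PT.snd))) (PT.memb (PT.left PT.snd)
    (PT.reach.comp (PT.fst.pair ((PT.right (PT.right PT.snd)).pair hc))))

theorem PT.certainGraph (k : ℕ) : PT (certainGraph (V := V) k) := by
  have hE : PT (fun q : (List (V × V) × (V × V)) × (V × V) => q.1.1) := PT.left PT.fst
  have hv : PT (fun q : (List (V × V) × (V × V)) × (V × V) => q.1.2.1) := PT.left (PT.right PT.fst)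
  refine PT.any (l := fun E : List (V × V) => E) PT.id (p := fun E e => E.all fun e' =>
    !CQA.memb e'.1 (CQA.reach E [] e.1) || (CQA.onCycle k E e' && !CQA.onLongCycle k E e')) ?_
  refine PT.all (l := fun q : List (V × V) × (V × V) => q.1) PT.fst (p := fun q e' =>
    !CQA.memb e'.1 (CQA.reach q.1 [] q.2.1) || (CQA.onCycle k q.1 e' && !CQA.onLongCycle k q.1 e')) ?_
  exact PT.or (PT.not (PT.memb (PT.left PT.snd) (PT.reach.comp (hE.pair ((PT.const []).pair hv)))))
    (PT.and ((PT.onCycle k).comp (hE.pair PT.snd)) (PT.not ((PT.onLongCycle k).comp (hE.pair PT.snd))))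

end algorithm

open Relation

/-! ### Choices without short cycles in layered graphs -/

section graph
variable {V : Type}

/-- `d` runs around a closed walk of length `k` in `E`. -/
def IsClosedWalk (k : ℕ) (E : Set (V × V)) (d : ℕ → V) : Prop :=
  (∀ i, (d i, d (i + 1)) ∈ E) ∧ ∀ i, d (i + k) = d i

/-- The edge `e` lies on a closed walk of length `k`. -/
def OnClosedWalk (k : ℕ) (E : Set (V × V)) (e : V × V) : Prop :=
  ∃ d, IsClosedWalk k E d ∧ d 0 = e.1 ∧ d 1 = e.2

/-- The edge `e` is the first edge of a walk of length `k` that does not return to its start, but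
that can be closed without visiting its inner vertices again. -/
def OnLongCycle (k : ℕ) (E : Set (V × V)) (e : V × V) : Prop :=
  ∃ a : ℕ → V, a 0 = e.1 ∧ a 1 = e.2 ∧ (∀ i < k, (a i, a (i + 1)) ∈ E) ∧ a k ≠ a 0 ∧
    ReflTransGen (fun x y => (x, y) ∈ E ∧ ∀ i, 0 < i → i < k → x ≠ a i ∧ y ≠ a i) (a k) (a 0)

/-- Every edge leads from one of `k` layers to the cyclically next one. -/
def IsLayered (k : ℕ) (E : Set (V × V)) (layer : V → ℕ) : Prop :=
  ∀ e ∈ E, layer e.2 ≡ layer e.1 + 1 [MOD k]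

/-- `s` contains at most one edge from every vertex. -/
def IsFunctional (s : Set (V × V)) : Prop := ∀ e ∈ s, ∀ e' ∈ s, e.1 = e'.1 → e = e'

theorem IsClosedWalk.mono {k : ℕ} {E E' : Set (V × V)} {d : ℕ → V} (h : IsClosedWalk k E d)
    (hE : ∀ i, (d i, d (i + 1)) ∈ E → (d i, d (i + 1)) ∈ E') : IsClosedWalk k E' d :=
  ⟨fun i => hE i (h.1 i), h.2⟩

theorem IsClosedWalk.shift {k : ℕ} {E : Set (V × V)} {d : ℕ → V} (h : IsClosedWalk k E d)
    (j : ℕ) : IsClosedWalk k E (fun i => d (j + i)) :=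
  ⟨fun i => h.1 (j + i), fun i =>
    (congrArg d (Nat.add_assoc j i k).symm).trans (h.2 (j + i))⟩

/-- Used in two ways: the first `k` vertices of a walk are distinct, and closed walks have length
divisible by `k`. -/
theorem IsLayered.walk {k : ℕ} {E : Set (V × V)} {layer : V → ℕ} (hl : IsLayered k E layer)
    {a : ℕ → V} {m : ℕ} (ha : ∀ i < m, (a i, a (i + 1)) ∈ E) :
    ∀ i ≤ m, layer (a i) ≡ layer (a 0) + i [MOD k] := by
  intro i
  induction i with
  | zero => intro _; rfl
  | succ i ih => intro hi; exact (hl _ (ha i (by omega))).trans ((ih (by omega)).add_right 1)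

/-- A reachable vertex can be reached along a path without repetitions. -/
theorem exists_path {r : V → V → Prop} {x y : V} (h : ReflTransGen r x y) :
    ∃ (n : ℕ) (p : ℕ → V), p 0 = x ∧ p n = y ∧ (∀ i < n, r (p i) (p (i + 1))) ∧
      ∀ i j, i < j → j ≤ n → p i ≠ p j := by
  classical
  have hex : ∃ n, ∃ p : ℕ → V, p 0 = x ∧ p n = y ∧ ∀ i < n, r (p i) (p (i + 1)) := by
    induction h with
    | refl => exact ⟨0, fun _ => x, rfl, rfl, by simp⟩
    | @tail b c _ hbc ih =>
      obtain ⟨n, p, h0, hn, hp⟩ := ih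
      refine ⟨n + 1, fun i => if i ≤ n then p i else c, by simp [h0], by simp, fun i hi => ?_⟩
      rcases Nat.lt_succ_iff_lt_or_eq.1 hi with h | rfl
      · simpa [h.le, h] using hp i h
      · simpa [hn] using hbc
  obtain ⟨p, h0, hn, hp⟩ := Nat.find_spec hex
  refine ⟨_, p, h0, hn, hp, fun i j hij hj heq => ?_⟩
  -- If a vertex is repeated, cutting out the segment between its two visits contradicts minimal
  -- length.
  refine Nat.find_min hex (m := Nat.find hex - (j - i)) (by omega)
    ⟨fun m => if m ≤ i then p m else p (m + (j - i)), by simp [h0], ?_, fun m hm => ?_⟩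
  · simp only
    split_ifs with h
    · have h1 : Nat.find hex - (j - i) = i := by omega
      have h2 : j = Nat.find hex := by omega
      rw [h1, heq, h2, hn]
    · rw [show Nat.find hex - (j - i) + (j - i) = Nat.find hex by omega, hn]
  · rcases lt_trichotomy m i with h | h | h
    · simp only [h.le, if_true, Nat.succ_le_of_lt h]
      exact hp m (by omega)
    · subst h
      have h1 : m + 1 + (j - m) = j + 1 := by omega
      simp only [le_refl, if_true, h1, heq, Nat.not_succ_le_self, if_false]
      exact hp j (by omega)
    · have h1 : m + 1 + (j - i) = m + (j - i) + 1 := by omega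
      simp only [Nat.not_le.2 h, if_false, h1, Nat.not_le.2 (h.trans (Nat.lt_succ_self m))]
      exact hp _ (by omega)

/-- Join the `k`-step walk to a repetition-free return path. The first `k` vertices lie in different
layers; the return path avoids the inner ones by assumption and meets `a 0` only at its end. It is
nonempty since `a k ≠ a 0`, so the cycle is longer than `k`. -/
theorem OnLongCycle.exists_cycle {k : ℕ} {E : Set (V × V)} {layer : V → ℕ}
    (hl : IsLayered k E layer) (hk : 0 < k) {e : V × V} (h : OnLongCycle k E e) :
    ∃ (L : ℕ) (c : ℕ → V), k < L ∧ IsClosedWalk L E c ∧ c 0 = e.1 ∧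
      ∀ i j, c i = c j → i ≡ j [MOD L] := by
  obtain ⟨a, ha0, -, ha, hne, hr⟩ := h
  obtain ⟨n, p, hp0, hpn, hp, hinj⟩ := exists_path hr
  have hn : 0 < n := by
    rcases Nat.eq_zero_or_pos n with rfl | h
    · exact absurd (hp0.symm.trans hpn) hne
    · exact h
  let b : ℕ → V := fun m => if m < k then a m else p (m - k)
  have hb : ∀ m < k + n, (b m, b (m + 1)) ∈ E := by
    intro m hm
    simp only [b]
    rcases lt_trichotomy (m + 1) k with h | h | h
    · simpa [h, (Nat.lt_succ_self m).trans h] using ha m (by omega)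
    · have := ha m (by omega)
      rw [h, ← hp0] at this
      simpa [h, show m < k by omega] using this
    · have := (hp (m - k) (by omega)).1
      simpa [show ¬ m < k by omega, show ¬ m + 1 < k by omega,
        show m + 1 - k = m - k + 1 by omega] using this
  have hbL : b (k + n) = b 0 := by simp [b, hk, hpn]
  have hlt : ∀ i j, i < j → j < k + n → b i ≠ b j := by
    intro i j hij hj heq
    simp only [b] at heq
    by_cases h1 : j < k
    · rw [if_pos h1, if_pos (hij.trans h1)] at heq
      have h2 := hl.walk ha i (by omega)
      have h3 := hl.walk ha j (by omega)
      rw [heq] at h2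
      have h4 : i ≡ j [MOD k] := Nat.ModEq.add_left_cancel' _ (h2.symm.trans h3)
      have h5 := Nat.ModEq.eq_of_lt_of_lt h4 (hij.trans h1) h1
      omega
    · rw [if_neg h1] at heq
      by_cases h2 : i < k
      · rw [if_pos h2] at heq
        rcases Nat.eq_zero_or_pos i with rfl | h3
        · exact hinj (j - k) n (by omega) le_rfl (by rw [← heq, hpn])
        · exact ((hp (j - k) (by omega)).2 i h3 h2).1 heq.symm
      · rw [if_neg h2] at heq
        exact hinj (i - k) (j - k) (by omega) (by omega) heq
  have hL : 0 < k + n := by omega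
  refine ⟨k + n, fun m => b (m % (k + n)), by omega, ⟨fun i => ?_, fun i => by simp⟩, ?_, ?_⟩
  · have h1 := hb (i % (k + n)) (Nat.mod_lt _ hL)
    have h2 : b (i % (k + n) + 1) = b ((i + 1) % (k + n)) := by
      rw [Nat.add_mod i 1]
      rcases Nat.lt_or_ge (i % (k + n) + 1) (k + n) with h | h
      · congr 1
        rw [Nat.mod_eq_of_lt (a := 1) (by omega), Nat.mod_eq_of_lt h]
      · have h3 : i % (k + n) + 1 = k + n := by have := Nat.mod_lt i hL; omega
        have h4 : k + n ≠ 1 := by omega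
        rw [Nat.mod_eq_of_lt (a := 1) (by omega), h3, hbL, Nat.mod_self]
    rwa [h2] at h1
  · simp [b, hk, ha0]
  · intro i j hij
    have hi := Nat.mod_lt i hL
    have hj := Nat.mod_lt j hL
    rcases lt_trichotomy (i % (k + n)) (j % (k + n)) with h | h | h
    · exact absurd hij (hlt _ _ h hj)
    · exact h
    · exact absurd hij.symm (hlt _ _ h hi)

/-- A choice without closed walks of length `k` that can be extended step by step: an edge whose
head has not been treated yet is not on any closed walk of length `k`. -/
structure IsPartialChoice (k : ℕ) (E s : Set (V × V)) : Prop where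
  subset : s ⊆ E
  functional : IsFunctional s
  free : ∀ d, ¬ IsClosedWalk k s d
  closed : ∀ e ∈ s, (∃ e' ∈ s, e'.1 = e.2) ∨ ¬ OnClosedWalk k E e

/-- If a closed walk of length `k` used `e`, the head of `e` would already have an edge in `s`. So
`e` is not a loop, and the edge preceding it on the walk lies in `s`; by `closed`, some edge of `s`
then starts at `e.1`, contrary to `hes`. -/
theorem IsPartialChoice.insert {k : ℕ} {E s : Set (V × V)} (hs : IsPartialChoice k E s)
    (hk : 0 < k) {e : V × V} (he : e ∈ E) (hes : ∀ e' ∈ s, e'.1 ≠ e.1)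
    (h : (∃ e' ∈ s, e'.1 = e.2) ∨ ¬ OnClosedWalk k E e) : IsPartialChoice k E (Insert.insert e s) := by
  have hsub : Insert.insert e s ⊆ E := Set.insert_subset he hs.subset
  refine ⟨hsub, ?_, ?_, ?_⟩
  · rintro x (rfl | hx) y (rfl | hy) hxy
    · rfl
    · exact absurd hxy.symm (hes y hy)
    · exact absurd hxy (hes x hx)
    · exact hs.functional x hx y hy hxy
  · intro d hd
    by_cases hi : ∃ i, (d i, d (i + 1)) = e
    · obtain ⟨i, hi⟩ := hi
      have hon : ∀ j, OnClosedWalk k E (d j, d (j + 1)) := fun j =>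
        ⟨_, (hd.mono fun i hi => hsub hi).shift j, rfl, rfl⟩
      have h1 : OnClosedWalk k E e := hi ▸ hon i
      obtain ⟨e', he', h2⟩ := h.resolve_right (not_not.2 h1)
      -- The edge preceding position `i`, taken one period later so that `i = 0` needs no special
      -- treatment.
      have h3 := hd.1 (i + k - 1)
      have h4 : d (i + k - 1 + 1) = e.1 := by
        rw [show i + k - 1 + 1 = i + k by omega, hd.2, ← hi]
      have h5 : ∀ x ∈ s, x.1 ≠ d (i + k - 1 + 1) := by rw [h4]; exact hes
      rcases h3 with h3 | h3
      · have h6 : e.2 = e.1 := by rw [← h4, ← h3]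
        exact hes e' he' (h2.trans h6)
      · rcases hs.closed _ h3 with ⟨x, hx, h6⟩ | h6
        · exact h5 x hx h6
        · exact h6 (hon _)
    · push Not at hi
      exact hs.free d (hd.mono fun i h => h.resolve_left (hi i))
  · rintro x (rfl | hx)
    · exact h.imp_left fun ⟨e', he', h⟩ => ⟨e', Or.inr he', h⟩
    · exact (hs.closed x hx).imp_left fun ⟨e', he', h⟩ => ⟨e', Or.inr he', h⟩

/-- A walk that meets the cycle cannot leave it, as no edge of `s` starts there, and it cannot close
after `k < L` steps because the cycle is elementary. A walk that misses the cycle lies in `s`. -/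
theorem IsPartialChoice.union_cycle {k L : ℕ} {E s : Set (V × V)} (hs : IsPartialChoice k E s)
    (hk : 0 < k) (hL : k < L) {c : ℕ → V} (hc : IsClosedWalk L E c)
    (hinj : ∀ i j, c i = c j → i ≡ j [MOD L]) (hcs : ∀ i, ∀ e ∈ s, e.1 ≠ c i) :
    IsPartialChoice k E (s ∪ Set.range fun i => (c i, c (i + 1))) := by
  have hmod : ∀ i j, i ≡ j [MOD L] → c i = c j := by
    have h1 : ∀ i m, c (i + m * L) = c i := by
      intro i m
      induction m with
      | zero => simp
      | succ m ih => rw [Nat.succ_mul, ← Nat.add_assoc, hc.2, ih]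
    have h2 : ∀ i, c i = c (i % L) := fun i => by
      conv_lhs => rw [← Nat.mod_add_div i L, mul_comm, h1]
    intro i j h
    rw [h2 i, h2 j, h]
  have hstep : ∀ i j, c i = c j → c (i + 1) = c (j + 1) := fun i j h =>
    hmod _ _ ((hinj i j h).add_right 1)
  refine ⟨?_, ?_, ?_, ?_⟩
  · rintro x (hx | ⟨i, rfl⟩)
    · exact hs.subset hx
    · exact hc.1 i
  · rintro x (hx | ⟨i, rfl⟩) y (hy | ⟨j, rfl⟩) hxy
    · exact hs.functional x hx y hy hxy
    · exact absurd hxy (hcs j x hx)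
    · exact absurd hxy.symm (hcs i y hy)
    · exact Prod.ext hxy (hstep i j hxy)
  · intro d hd
    by_cases hj : ∃ j i, d j = c i
    · obtain ⟨j, i, hji⟩ := hj
      have hall : ∀ m, d (j + m) = c (i + m) := by
        intro m
        induction m with
        | zero => exact hji
        | succ m ih =>
          rcases hd.1 (j + m) with h | ⟨i', h⟩
          · exact absurd ih (hcs (i + m) _ h)
          · have h1 : c i' = d (j + m) := congrArg Prod.fst h
            have h2 : c (i' + 1) = d (j + m + 1) := congrArg Prod.snd h
            rw [← Nat.add_assoc, ← h2, ← Nat.add_assoc]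
            exact hstep _ _ (h1.trans ih)
      have h1 : c (i + k) = c i := by rw [← hall, hd.2, hji]
      have h2 : i + k ≡ i + 0 [MOD L] := hinj _ _ h1
      have h3 := Nat.ModEq.eq_of_lt_of_lt (Nat.ModEq.add_left_cancel' _ h2) hL (by omega)
      omega
    · push Not at hj
      refine hs.free d (hd.mono fun i h => h.resolve_right ?_)
      rintro ⟨i', h⟩
      exact hj i i' (congrArg Prod.fst h).symm
  · rintro x (hx | ⟨i, rfl⟩)
    · exact (hs.closed x hx).imp_left fun ⟨e', he', h⟩ => ⟨e', Or.inl he', h⟩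
    · exact Or.inl ⟨_, Or.inr ⟨i + 1, rfl⟩, rfl⟩

theorem IsClosedWalk.reachable {L : ℕ} {E : Set (V × V)} {c : ℕ → V} (hc : IsClosedWalk L E c)
    (i : ℕ) : ReflTransGen (fun x y => (x, y) ∈ E) (c 0) (c i) := by
  induction i with
  | zero => rfl
  | succ i ih => exact ih.tail (hc.1 i)

/-- If every edge leads to an edge that is not on a closed walk of length `k` or that is on a long
cycle, then some choice has no closed walk of length `k`. -/
theorem exists_choice {k : ℕ} {E : Set (V × V)} (hfin : E.Finite) {layer : V → ℕ}
    (hl : IsLayered k E layer) (hk : 0 < k)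
    (h : ∀ e ∈ E, ∃ e' ∈ E, ReflTransGen (fun x y => (x, y) ∈ E) e.1 e'.1 ∧
      (¬ OnClosedWalk k E e' ∨ OnLongCycle k E e')) :
    ∃ s ⊆ E, IsFunctional s ∧ (∀ e ∈ E, ∃ e' ∈ s, e'.1 = e.1) ∧ ∀ d, ¬ IsClosedWalk k s d := by
  have hne : {s : Set (V × V) | IsPartialChoice k E s}.Nonempty :=
    ⟨∅, Set.empty_subset _, fun _ h => h.elim, fun d hd => hd.1 0, fun _ h => h.elim⟩
  have hfin' : {s : Set (V × V) | IsPartialChoice k E s}.Finite :=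
    hfin.finite_subsets.subset fun s hs => hs.subset
  obtain ⟨s, hs⟩ := hfin'.exists_maximal hne
  refine ⟨s, hs.prop.subset, hs.prop.functional, ?_, hs.prop.free⟩
  have hins : ∀ e ∈ E, (∀ e' ∈ s, e'.1 ≠ e.1) → ¬ ((∃ e' ∈ s, e'.1 = e.2) ∨ ¬ OnClosedWalk k E e) := by
    intro e he hes h'
    have := hs.le_of_ge (hs.prop.insert hk he hes h') (Set.subset_insert e s)
    exact hes e (this (Set.mem_insert e s)) rfl
  by_contra! hcon
  obtain ⟨e, he, hes⟩ := hcon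
  -- Being untreated spreads along edges: an edge from an untreated vertex to a treated one could be
  -- inserted, against maximality.
  have hout : ∀ x, ReflTransGen (fun x y => (x, y) ∈ E) e.1 x → ∀ e' ∈ s, e'.1 ≠ x := by
    intro x hx
    induction hx with
    | refl => exact hes
    | @tail b c _ hbc ih =>
      intro e' he' heq
      exact hins _ hbc ih (Or.inl ⟨e', he', heq⟩)
  obtain ⟨e', he', hr, hbad⟩ := h e he
  rcases hbad with hbad | hbad
  · exact hins e' he' (hout _ hr) (Or.inr hbad)
  · obtain ⟨L, c, hL, hc, hc0, hinj⟩ := hbad.exists_cycle hl hk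
    have hcs : ∀ i, ∀ e ∈ s, e.1 ≠ c i := fun i =>
      hout _ (hr.trans (hc0 ▸ hc.reachable i))
    have := hs.le_of_ge (hs.prop.union_cycle hk hL hc hinj hcs) Set.subset_union_left
    exact hcs 0 (c 0, c 1) (this (Or.inr ⟨0, rfl⟩)) rfl

/-- A choice without closed walks of length `k` leads from every edge to an edge that is not on a
closed walk of length `k` or that is on a long cycle. -/
theorem exists_of_choice {k : ℕ} {E : Set (V × V)} (hfin : E.Finite) {layer : V → ℕ}
    (hl : IsLayered k E layer) {s : Set (V × V)} (hsE : s ⊆ E)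
    (htot : ∀ e ∈ E, ∃ e' ∈ s, e'.1 = e.1) (hfree : ∀ d, ¬ IsClosedWalk k s d) {e : V × V}
    (he : e ∈ E) :
    ∃ e' ∈ E, ReflTransGen (fun x y => (x, y) ∈ E) e.1 e'.1 ∧
      (¬ OnClosedWalk k E e' ∨ OnLongCycle k E e') := by
  classical
  by_contra! hcon
  -- The choice stays within these vertices: each edge taken lies on a closed walk, whose next
  -- vertex `d 2` shows that its head has an outgoing edge.
  let G : Type := {x : V // ReflTransGen (fun x y => (x, y) ∈ E) e.1 x ∧ ∃ y, (x, y) ∈ E}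
  have hnext : ∀ x : G, ∃ y : G, (x.1, y.1) ∈ s := by
    rintro ⟨x, hx, y, hxy⟩
    obtain ⟨⟨x', z⟩, hz, hx'⟩ := htot _ hxy
    obtain rfl : x' = x := hx'
    obtain ⟨⟨d, hd, -, hd1⟩, -⟩ := hcon _ (hsE hz) hx
    exact ⟨⟨z, hx.tail (hsE hz), d 2, by have := hd.1 1; rwa [hd1] at this⟩, hz⟩
  choose f hf using hnext
  let start : G := ⟨e.1, .refl, e.2, he⟩
  let v : ℕ → G := fun n => f^[n] start
  have hv : ∀ n, ((v n).1, (v (n + 1)).1) ∈ s := by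
    intro n
    simp only [v, Function.iterate_succ_apply']
    exact hf _
  have hshift : ∀ i j m, v i = v j → v (i + m) = v (j + m) := by
    intro i j m h
    simp only [v] at *
    rw [Nat.add_comm i, Nat.add_comm j, Function.iterate_add_apply, h, Function.iterate_add_apply]
  -- The least `L` is taken over all starting points `i` at once, so vertices fewer than `L` steps
  -- apart are distinct.
  have hper : ∃ L, 0 < L ∧ ∃ i, v i = v (i + L) := by
    obtain ⟨m, n, hmn, heq⟩ := (hfin.image Prod.fst).exists_lt_map_eq_of_forall_mem
      (f := fun n => (v n).1) (fun n => Set.mem_image_of_mem Prod.fst (hsE (hv n)))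
    refine ⟨n - m, by omega, m, Subtype.ext ?_⟩
    rw [Nat.add_sub_cancel' hmn.le]
    exact heq
  obtain ⟨hpos, i, hi⟩ := Nat.find_spec hper
  have hmin := fun m (hm : m < Nat.find hper) => Nat.find_min hper hm
  generalize Nat.find hper = L at hpos hi hmin
  have hLk : L ≠ k := by
    rintro rfl
    exact hfree (fun n => (v (i + n)).1) ⟨fun n => hv (i + n), fun n => by
      have h := hshift i (i + L) n hi
      rw [Nat.add_assoc, Nat.add_comm L n] at h
      exact congrArg Subtype.val h.symm⟩
  have hdvd : k ∣ L := by
    have h1 := hl.walk (a := fun n => (v (i + n)).1) (m := L) (fun n _ => hsE (hv (i + n))) L le_rfl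
    simp only [← hi, Nat.add_zero] at h1
    exact (Nat.modEq_zero_iff_dvd.1 (Nat.ModEq.add_left_cancel' (layer (v i).1) h1.symm))
  have hlt : k < L := lt_of_le_of_ne (Nat.le_of_dvd hpos hdvd) hLk.symm
  have hdist : ∀ a b, a < b → b - a < L → v (i + a) ≠ v (i + b) := fun a b hab hb heq =>
    hmin (b - a) hb ⟨by omega, i + a, by rw [heq]; congr 1; omega⟩
  -- The first `k` edges of the cycle of length `L` serve as the walk, the other `L - k` as the
  -- return path.
  refine (hcon _ (hsE (hv i)) (v i).2.1).2 ⟨fun n => (v (i + n)).1, rfl, rfl,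
    fun n _ => hsE (hv (i + n)), fun heq => ?_, ?_⟩
  · by_cases hk : k = 0
    · obtain rfl : k = 0 := hk
      have : L = 0 := by simpa using hdvd
      omega
    · exact hdist 0 k (by omega) (by omega) (Subtype.ext heq.symm)
  · have key : ∀ m, k + m ≤ L → ReflTransGen (fun x y => (x, y) ∈ E ∧ ∀ j, 0 < j → j < k →
        x ≠ (v (i + j)).1 ∧ y ≠ (v (i + j)).1) (v (i + k)).1 (v (i + (k + m))).1 := by
      intro m
      induction m with
      | zero => intro _; rfl
      | succ m ih =>
        intro hm
        refine (ih (by omega)).tail ⟨hsE (hv _), fun j hj hjk => ⟨fun h => ?_, fun h => ?_⟩⟩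
        · exact hdist j (k + m) (by omega) (by omega) (Subtype.ext h.symm)
        · exact hdist j (k + m + 1) (by omega) (by omega) (Subtype.ext h.symm)
    have := key (L - k) (by omega)
    rw [show k + (L - k) = L by omega, ← hi] at this
    exact this

end graph

/-! ### Correctness of the graph algorithm -/

section correctness
variable {V : Type} {E : List (V × V)}

theorem mem_extend {I acc : List V} {e : V × V} {x : V} :
    x ∈ extend I acc e ↔ x ∈ acc ∨ (x = e.2 ∧ e.1 ∈ acc ∧ e.1 ∉ I ∧ e.2 ∉ I) := by
  unfold extend
  split_ifs with h
  · simp only [Bool.and_eq_true, Bool.not_eq_true', memb_iff, ← Bool.not_eq_true] at h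
    simp [h, or_comm]
  · simp only [Bool.and_eq_true, Bool.not_eq_true', memb_iff, ← Bool.not_eq_true] at h
    constructor
    · exact Or.inl
    · rintro (h' | ⟨-, h'⟩)
      · exact h'
      · exact absurd h' h

theorem mem_foldl_extend_of_mem {I acc : List V} {l : List (V × V)} {x : V} (h : x ∈ acc) :
    x ∈ l.foldl (extend I) acc := by
  induction l generalizing acc with
  | nil => exact h
  | cons e l ih => exact ih (mem_extend.2 (Or.inl h))

theorem mem_foldl_extend_of_edge {I acc : List V} {l : List (V × V)} {x y : V} (h : x ∈ acc)
    (he : (x, y) ∈ l) (hx : x ∉ I) (hy : y ∉ I) : y ∈ l.foldl (extend I) acc := by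
  induction l generalizing acc with
  | nil => simp at he
  | cons e l ih =>
    rcases List.mem_cons.1 he with rfl | he
    · exact mem_foldl_extend_of_mem (acc := extend I acc (x, y))
        (mem_extend.2 (Or.inr ⟨rfl, h, hx, hy⟩))
    · exact ih (mem_extend.2 (Or.inl h)) he

theorem reachable_of_mem_foldl_extend {I acc : List V} {v : V} {l : List (V × V)} (hl : l ⊆ E)
    (h : ∀ x ∈ acc, ReflTransGen (fun x y => (x, y) ∈ E ∧ x ∉ I ∧ y ∉ I) v x) :
    ∀ x ∈ l.foldl (extend I) acc,
      ReflTransGen (fun x y => (x, y) ∈ E ∧ x ∉ I ∧ y ∉ I) v x := by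
  induction l generalizing acc with
  | nil => exact h
  | cons e l ih =>
    refine ih (fun a ha => hl (List.mem_cons_of_mem _ ha)) fun x hx => ?_
    rcases mem_extend.1 hx with hx | ⟨rfl, h1, h2, h3⟩
    · exact h x hx
    · exact (h _ h1).tail ⟨hl List.mem_cons_self, h2, h3⟩

/-- Each pass over `E` advances at least one edge along any given path. A repetition-free path has
distinct edges, so `E.length` passes suffice. -/
theorem mem_reach {I : List V} {v x : V} :
    x ∈ reach E I v ↔ ReflTransGen (fun x y => (x, y) ∈ E ∧ x ∉ I ∧ y ∉ I) v x := by
  classical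
  have hit : reach E I v = (fun acc => E.foldl (extend I) acc)^[E.length] [v] := by
    rw [reach, List.foldl_const]
  rw [hit]
  constructor
  · have : ∀ n, ∀ x ∈ (fun acc => E.foldl (extend I) acc)^[n] [v],
        ReflTransGen (fun x y => (x, y) ∈ E ∧ x ∉ I ∧ y ∉ I) v x := by
      intro n
      induction n with
      | zero => intro x hx; obtain rfl : x = v := by simpa using hx
                rfl
      | succ n ih =>
        rw [Function.iterate_succ_apply']
        exact reachable_of_mem_foldl_extend (fun _ h => h) ih
    exact this _ x
  · intro h
    obtain ⟨n, p, hp0, hpn, hp, hinj⟩ := exists_path h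
    have hn : n ≤ E.length := by
      have h1 : (Finset.range n).image (fun i => (p i, p (i + 1))) ⊆ E.toFinset := by
        intro e he
        obtain ⟨i, hi, rfl⟩ := Finset.mem_image.1 he
        simpa using (hp i (by simpa using hi)).1
      have h2 := (Finset.card_le_card h1).trans E.toFinset_card_le
      rwa [Finset.card_image_of_injOn, Finset.card_range] at h2
      intro i hi j hj hij
      simp only [Finset.coe_range, Set.mem_Iio] at hi hj
      have h3 : p i = p j := congrArg Prod.fst hij
      rcases lt_trichotomy i j with h | h | h
      · exact absurd h3 (hinj i j h (by omega))
      · exact h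
      · exact absurd h3.symm (hinj j i h (by omega))
    have hmem : ∀ i ≤ n, ∀ m, i ≤ m → p i ∈ (fun acc => E.foldl (extend I) acc)^[m] [v] := by
      intro i hi m hm
      induction m generalizing i with
      | zero => obtain rfl : i = 0 := by omega
                simp [hp0]
      | succ m ih =>
        rw [Function.iterate_succ_apply']
        rcases Nat.lt_or_ge m i with h | h
        · obtain rfl : i = m + 1 := by omega
          obtain ⟨h1, h2, h3⟩ := hp m (by omega)
          exact mem_foldl_extend_of_edge (ih m (by omega) le_rfl) h1 h2 h3
        · exact mem_foldl_extend_of_mem (ih i hi h)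
    rw [← hpn]
    exact hmem n le_rfl _ hn

/-- The end `w j` is not recorded. With `j = k - 1` and the walk starting at the head of `e`, the
record consists exactly of the inner vertices. -/
theorem walkTest_iff {P : List (V × V) × V × V × List V → Bool} {j : ℕ} {a cur : V} {I : List V} :
    walkTest P j (E, a, cur, I) = true ↔ ∃ w : ℕ → V, w 0 = cur ∧
      (∀ i < j, (w i, w (i + 1)) ∈ E) ∧
      P (E, a, w j, ((List.range j).map w).reverse ++ I) = true := by
  induction j generalizing cur I with
  | zero =>
    constructor
    · intro h; exact ⟨fun _ => cur, rfl, by simp, by simpa [walkTest] using h⟩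
    · rintro ⟨w, rfl, -, h⟩; simpa [walkTest] using h
  | succ j ih =>
    simp only [walkTest, List.any_eq_true, Bool.and_eq_true, eqb_iff, ih]
    constructor
    · rintro ⟨⟨x, y⟩, he, rfl, w, hw0, hw, hP⟩
      simp only at hw0
      refine ⟨fun i => Nat.casesOn i x w, rfl, fun i hi => ?_, ?_⟩
      · cases i with
        | zero => simpa [hw0] using he
        | succ i => exact hw i (by omega)
      · rw [List.range_succ_eq_map]
        simpa [Function.comp_def] using hP
    · rintro ⟨w, rfl, hw, hP⟩
      refine ⟨(w 0, w 1), hw 0 (by omega), rfl, fun i => w (i + 1), rfl,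
        fun i hi => hw (i + 1) (by omega), ?_⟩
      rw [List.range_succ_eq_map] at hP
      simpa [Function.comp_def] using hP

/-- The search finds `k - 1` edges from the head of `e` back to its tail; prefixing `e` and reading
indices modulo `k` gives the periodic walk. -/
theorem onCycle_iff {k : ℕ} (hk : 2 ≤ k) {e : V × V} (he : e ∈ E) :
    onCycle k E e = true ↔ OnClosedWalk k {e | e ∈ E} e := by
  rw [onCycle, walkTest_iff]
  constructor
  · rintro ⟨w, hw0, hw, hP⟩
    simp only [eqb_iff] at hP
    have hb : ∀ r < k, ((if r = 0 then e.1 else w (r - 1)), w r) ∈ E := by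
      intro r hr
      split_ifs with h
      · subst h; rw [hw0]; exact he
      · have := hw (r - 1) (by omega)
        rwa [Nat.sub_add_cancel (by omega)] at this
    refine ⟨fun m => if m % k = 0 then e.1 else w (m % k - 1), ⟨fun i => ?_, fun i => by simp⟩,
      by simp, by simp [Nat.mod_eq_of_lt (show 1 < k by omega), hw0]⟩
    have h1 := hb (i % k) (Nat.mod_lt _ (by omega))
    have h2 : (if (i + 1) % k = 0 then e.1 else w ((i + 1) % k - 1)) = w (i % k) := by
      have h3 := Nat.mod_lt i (show 0 < k by omega)
      rw [Nat.add_mod, Nat.mod_eq_of_lt (show 1 < k by omega)]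
      rcases Nat.lt_or_ge (i % k + 1) k with h | h
      · rw [Nat.mod_eq_of_lt h]; simp
      · have h4 : i % k + 1 = k := by omega
        rw [h4, Nat.mod_self, if_pos rfl, ← hP]
        congr 1; omega
    change (_, _) ∈ E
    simpa only [h2] using h1
  · rintro ⟨d, hd, h0, h1⟩
    refine ⟨fun i => d (i + 1), h1, fun i _ => hd.1 (i + 1), ?_⟩
    rw [eqb_iff]
    have := hd.2 0
    simp only [Nat.zero_add] at this
    change d (k - 1 + 1) = e.1
    rw [show k - 1 + 1 = k by omega, this, h0]

theorem onLongCycle_iff {k : ℕ} (hk : 2 ≤ k) {e : V × V} (he : e ∈ E) :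
    onLongCycle k E e = true ↔ OnLongCycle k {e | e ∈ E} e := by
  rw [onLongCycle, walkTest_iff]
  have hI : ∀ (w a : ℕ → V), (∀ i, a (i + 1) = w i) → ∀ x,
      x ∉ ((List.range (k - 1)).map w).reverse ++ [] ↔ ∀ i, 0 < i → i < k → x ≠ a i := by
    intro w a hwa x
    simp only [List.append_nil, List.mem_reverse, List.mem_map, List.mem_range, not_exists, not_and]
    constructor
    · intro h i hi hik heq
      exact h (i - 1) (by omega) (by rw [← hwa, Nat.sub_add_cancel hi, heq])
    · intro h i hi heq
      exact h (i + 1) (by omega) (by omega) (by rw [hwa, heq])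
  have hR : ∀ (w a : ℕ → V), (∀ i, a (i + 1) = w i) →
      (fun x y => (x, y) ∈ E ∧ x ∉ ((List.range (k - 1)).map w).reverse ++ [] ∧
        y ∉ ((List.range (k - 1)).map w).reverse ++ []) =
      (fun x y => (x, y) ∈ {e | e ∈ E} ∧ ∀ i, 0 < i → i < k → x ≠ a i ∧ y ≠ a i) := by
    intro w a hwa
    funext x y
    rw [hI w a hwa, hI w a hwa]
    simp only [Set.mem_ofPred_eq, eq_iff_iff, and_congr_right_iff]
    intro _
    exact ⟨fun h i h1 h2 => ⟨h.1 i h1 h2, h.2 i h1 h2⟩,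
      fun h => ⟨fun i h1 h2 => (h i h1 h2).1, fun i h1 h2 => (h i h1 h2).2⟩⟩
  simp only [Bool.and_eq_true, Bool.not_eq_true', ← Bool.not_eq_true, eqb_iff, memb_iff, mem_reach]
  constructor
  · rintro ⟨w, hw0, hw, hne, hr⟩
    let a : ℕ → V := fun i => Nat.casesOn i e.1 w
    have hak : a k = w (k - 1) := by
      obtain ⟨j, rfl⟩ : ∃ j, k = j + 1 := ⟨k - 1, by omega⟩
      rfl
    rw [hR w a fun _ => rfl, ← hak] at hr
    refine ⟨a, rfl, hw0, fun i hi => ?_, by rw [hak]; exact hne, hr⟩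
    cases i with
    | zero => simpa [a, hw0] using he
    | succ i => exact hw i (by omega)
  · rintro ⟨a, h0, h1, ha, hne, hr⟩
    have hak : a (k - 1 + 1) = a k := by congr 1; omega
    refine ⟨fun i => a (i + 1), h1, fun i hi => ha (i + 1) (by omega), ?_, ?_⟩
    · change a (k - 1 + 1) ≠ e.1
      rw [hak, ← h0]; exact hne
    · rw [hR (fun i => a (i + 1)) a fun _ => rfl]
      change ReflTransGen _ (a (k - 1 + 1)) e.1
      rw [hak, ← h0]; exact hr

theorem certainGraph_eq_false_iff {k : ℕ} (hk : 2 ≤ k) {layer : V → ℕ}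
    (hl : IsLayered k {e | e ∈ E} layer) :
    certainGraph k E = false ↔ ∃ s ⊆ {e | e ∈ E}, IsFunctional s ∧
      (∀ e ∈ E, ∃ e' ∈ s, e'.1 = e.1) ∧ ∀ d, ¬ IsClosedWalk k s d := by
  have hfin : {e | e ∈ E}.Finite := E.finite_toSet
  have h : certainGraph k E = false ↔ ∀ e ∈ E, ∃ e' ∈ E,
      ReflTransGen (fun x y => (x, y) ∈ {e | e ∈ E}) e.1 e'.1 ∧
      (¬ OnClosedWalk k {e | e ∈ E} e' ∨ OnLongCycle k {e | e ∈ E} e') := by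
    rw [← Bool.not_eq_true, certainGraph, List.any_eq_true]
    push Not
    refine forall₂_congr fun e he => ?_
    rw [ne_eq, List.all_eq_true]
    push Not
    refine exists_congr fun e' => and_congr_right fun he' => ?_
    rw [← onCycle_iff hk he', ← onLongCycle_iff hk he']
    have hm : memb e'.1 (reach E [] e.1) = true ↔
        ReflTransGen (fun x y => (x, y) ∈ {e | e ∈ E}) e.1 e'.1 := by
      rw [memb_iff, mem_reach]; simp
    rw [← hm]
    cases memb e'.1 (reach E [] e.1) <;> cases onCycle k E e' <;> cases onLongCycle k E e' <;> simp
  rw [h]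
  constructor
  · exact exists_choice hfin hl (by omega)
  · rintro ⟨s, hsE, -, htot, hfree⟩ e he
    exact exists_of_choice hfin hl hsE htot hfree he

end correctness

/-! ### Repairs and choices -/

section repairs
variable {Rel : Type} {S : Schema Rel} {k : ℕ} {R : Fin k → Rel}

/-- The fact `A` is represented by the edge `e` from its first argument to its second argument. -/
def IsEdge (R : Fin k → Rel) (A : Fact S) (e : (ℕ × Const) × (ℕ × Const)) : Prop :=
  ∃ i : Fin k, A.rel = R i ∧ e = ((i.val, A.args.headI), ((i.val + 1) % k, A.args.tail.headI))

/-- The edges that represent the facts in `r`. -/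
def edges (R : Fin k → Rel) (r : Set (Fact S)) : Set ((ℕ × Const) × (ℕ × Const)) :=
  {e | ∃ A ∈ r, IsEdge R A e}

/-- Tagging constants with their position makes the graph layered even when a constant occurs in
several positions. -/
theorem isLayered_edges (r : Set (Fact S)) : IsLayered k (edges R r) Prod.fst := by
  rintro e ⟨A, -, i, -, rfl⟩
  exact Nat.mod_modEq _ _

theorem args_eq (harity : ∀ i, S.arity (R i) = 2) {A : Fact S} {i : Fin k} (h : A.rel = R i) :
    A.args = [A.args.headI, A.args.tail.headI] := by
  have h2 : A.args.length = 2 := by rw [A.length_args, h, harity]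
  obtain ⟨a, b, hab⟩ := List.length_eq_two.1 h2
  rw [hab]
  rfl

theorem IsEdge.unique (hinj : Function.Injective R) {A : Fact S} {e e'}
    (h : IsEdge R A e) (h' : IsEdge R A e') : e = e' := by
  obtain ⟨i, hi, rfl⟩ := h
  obtain ⟨j, hj, rfl⟩ := h'
  obtain rfl : i = j := hinj (hi.symm.trans hj)
  rfl

theorem IsEdge.keyEqual_iff (hinj : Function.Injective R) (harity : ∀ i, S.arity (R i) = 2)
    (hkey : ∀ i, S.keyLen (R i) = 1) {A B : Fact S} {e e'} (h : IsEdge R A e)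
    (h' : IsEdge R B e') : KeyEqual A B ↔ e.1 = e'.1 := by
  obtain ⟨i, hi, rfl⟩ := h
  obtain ⟨j, hj, rfl⟩ := h'
  have h1 : A.args.take (S.keyLen A.rel) = [A.args.headI] := by
    rw [hi, hkey, args_eq harity hi]; rfl
  have h2 : B.args.take (S.keyLen B.rel) = [B.args.headI] := by
    rw [hj, hkey, args_eq harity hj]; rfl
  rw [KeyEqual, h1, h2, hi, hj, hinj.eq_iff]
  simp [Prod.ext_iff, Fin.ext_iff]

theorem IsEdge.of_keyEqual {A B : Fact S} {e} (h : IsEdge R A e) (hAB : KeyEqual A B) :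
    ∃ e', IsEdge R B e' := by
  obtain ⟨i, hi, -⟩ := h
  exact ⟨_, i, hAB.1.symm.trans hi, rfl⟩

theorem IsEdge.injective (harity : ∀ i, S.arity (R i) = 2) {A B : Fact S} {e}
    (h : IsEdge R A e) (h' : IsEdge R B e) : A = B := by
  obtain ⟨i, hi, rfl⟩ := h
  obtain ⟨j, hj, h⟩ := h'
  simp only [Prod.mk.injEq] at h
  obtain rfl : i = j := Fin.ext h.1.1
  refine RelExpr.ext (hi.trans hj.symm) ?_
  rw [args_eq harity hi, args_eq harity hj, h.1.2, h.2.2]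

theorem mem_cycleQuery {harity : ∀ i, S.arity (R i) = 2} {F : Atom S} :
    F ∈ cycleQuery S R harity ↔ ∃ i : Fin k, F = { rel := R i
                                                   args := [Term.var i.val, Term.var ((i.val + 1) % k)]
                                                   length_args := (harity i).symm } := by
  classical
  simp [cycleQuery, eq_comm]

theorem satisfies_iff (hinj : Function.Injective R) (harity : ∀ i, S.arity (R i) = 2)
    (r : Database S) :
    Satisfies r (cycleQuery S R harity) ↔ k = 0 ∨ ∃ d, IsClosedWalk k (edges R (r : Set (Fact S))) d := by
  rcases Nat.eq_zero_or_pos k with rfl | hk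
  · simp only [true_or, iff_true]
    exact ⟨fun _ => [], fun F hF => by obtain ⟨i, -⟩ := mem_cycleQuery.1 hF; exact i.elim0⟩
  constructor
  · rintro ⟨θ, hθ⟩
    refine Or.inr ⟨fun m => (m % k, θ (m % k)), fun m => ?_, fun m => by simp⟩
    let i : Fin k := ⟨m % k, Nat.mod_lt _ hk⟩
    have h1 : (m + 1) % k = (i.val + 1) % k := by simp [i]
    refine ⟨_, hθ _ (mem_cycleQuery.2 ⟨i, rfl⟩), i, rfl, ?_⟩
    change ((m % k, θ (m % k)), ((m + 1) % k, θ ((m + 1) % k))) = _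
    rw [h1]
    rfl
  · rintro (h | ⟨d, hd⟩)
    · omega
    have hfst : ∀ m, (d m).1 < k ∧ (d (m + 1)).1 = ((d m).1 + 1) % k := by
      intro m
      obtain ⟨A, -, i, -, h⟩ := hd.1 m
      have h1 := congrArg (fun e => e.1.1) h
      have h2 := congrArg (fun e => e.2.1) h
      simp only at h1 h2
      rw [h1, h2]
      exact ⟨i.2, rfl⟩
    -- A closed walk may start in any layer; rotating it to layer `0` makes vertex `i` supply the
    -- value of variable `i`.
    obtain ⟨d, hd, h0, hstep⟩ : ∃ d, IsClosedWalk k (edges R (r : Set (Fact S))) d ∧ (d 0).1 = 0 ∧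
        ∀ m, (d (m + 1)).1 = ((d m).1 + 1) % k := by
      refine ⟨_, hd.shift (k - (d 0).1), ?_, fun m => (hfst _).2⟩
      have : ∀ m, (d m).1 = ((d 0).1 + m) % k := by
        intro m
        induction m with
        | zero => rw [Nat.add_zero, Nat.mod_eq_of_lt (hfst 0).1]
        | succ m ih => rw [(hfst m).2, ih, Nat.mod_add_mod, Nat.add_assoc]
      simp only [Nat.add_zero]
      rw [this, Nat.add_sub_cancel' (hfst 0).1.le, Nat.mod_self]
    have hidx : ∀ m, (d m).1 = m % k := by
      intro m
      induction m with
      | zero => rw [h0, Nat.zero_mod]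
      | succ m ih => rw [hstep, ih, Nat.mod_add_mod]
    refine ⟨fun x => (d x).2, fun F hF => ?_⟩
    obtain ⟨i, rfl⟩ := mem_cycleQuery.1 hF
    obtain ⟨A, hA, j, hj, h⟩ := hd.1 i
    have h1 := congrArg (fun e => e.1.1) h
    have h2 := congrArg (fun e => e.1.2) h
    have h3 := congrArg (fun e => e.2.2) h
    simp only at h1 h2 h3
    rw [hidx, Nat.mod_eq_of_lt i.2] at h1
    obtain rfl : i = j := Fin.ext h1
    have h4 : d ((i.val + 1) % k) = d (i.val + 1) := by
      rcases Nat.lt_or_ge (i.val + 1) k with h | h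
      · rw [Nat.mod_eq_of_lt h]
      · have h5 : i.val + 1 = 0 + k := by omega
        rw [h5, hd.2, Nat.zero_add, Nat.mod_self]
    refine Finset.mem_coe.1 (Set.mem_of_eq_of_mem (RelExpr.ext hj.symm ?_) hA)
    rw [args_eq harity hj, ← h2, ← h3, ← h4]
    rfl

/-- The edges of a repair form a choice, total by maximality. Conversely, the facts behind a choice
extend to a repair, and the extension creates no new edge: its edges share their sources with edges
of `s`, whose facts are already present. -/
theorem not_certain_iff (hk : 2 ≤ k) (hinj : Function.Injective R)
    (harity : ∀ i, S.arity (R i) = 2) (hkey : ∀ i, S.keyLen (R i) = 1) (db : Database S) :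
    db ∉ certainty (cycleQuery S R harity) ↔ ∃ s ⊆ edges R (db : Set (Fact S)), IsFunctional s ∧
      (∀ e ∈ edges R (db : Set (Fact S)), ∃ e' ∈ s, e'.1 = e.1) ∧ ∀ d, ¬ IsClosedWalk k s d := by
  classical
  constructor
  · intro h
    simp only [certainty, Set.mem_ofPred_eq, not_forall] at h
    obtain ⟨r, hr, hsat⟩ := h
    rw [satisfies_iff hinj] at hsat
    refine ⟨edges R (r : Set (Fact S)), ?_, ?_, ?_, fun d hd => hsat (Or.inr ⟨d, hd⟩)⟩
    · rintro e ⟨A, hA, he⟩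
      exact ⟨A, hr.prop.1 hA, he⟩
    · rintro e ⟨A, hA, he⟩ e' ⟨A', hA', he'⟩ heq
      obtain rfl := hr.prop.2 A hA A' hA' ((he.keyEqual_iff hinj harity hkey he').2 heq)
      exact he.unique hinj he'
    · rintro e ⟨A, hA, he⟩
      by_cases hex : ∃ B ∈ r, KeyEqual A B
      · obtain ⟨B, hB, hAB⟩ := hex
        obtain ⟨e', he'⟩ := he.of_keyEqual hAB
        exact ⟨e', ⟨B, hB, he'⟩, ((he.keyEqual_iff hinj harity hkey he').1 hAB).symm⟩
      · push Not at hex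
        have hcons : insert A r ⊆ db ∧ Consistent (insert A r) := by
          refine ⟨Finset.insert_subset hA hr.prop.1, ?_⟩
          intro B hB C hC hBC
          rcases Finset.mem_insert.1 hB with hB' | hB' <;>
            rcases Finset.mem_insert.1 hC with hC' | hC'
          · rw [hB', hC']
          · exact absurd (hB' ▸ hBC) (hex C hC')
          · exact absurd (hC' ▸ ⟨hBC.1.symm, hBC.2.symm⟩) (hex B hB')
          · exact hr.prop.2 B hB' C hC' hBC
        exact absurd ⟨rfl, rfl⟩ (hex A (hr.le_of_ge hcons (Finset.subset_insert A r)
          (Finset.mem_insert_self A r)))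
  · rintro ⟨s, hs, hfun, htot, hfree⟩
    let r₀ : Database S := db.filter fun A => ∃ e ∈ s, IsEdge R A e
    have hr₀ : Consistent r₀ := by
      intro A hA B hB hAB
      obtain ⟨-, e, he, hAe⟩ := Finset.mem_filter.1 hA
      obtain ⟨-, e', he', hBe'⟩ := Finset.mem_filter.1 hB
      obtain rfl := hfun e he e' he' ((hAe.keyEqual_iff hinj harity hkey hBe').1 hAB)
      exact hAe.injective harity hBe'
    have hfin : {t : Database S | t ⊆ db ∧ Consistent t}.Finite :=
      (Finset.finite_toSet db.powerset).subset fun t ht => Finset.mem_coe.2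
        (Finset.mem_powerset.2 ht.1)
    -- An extension is needed because `db` may contain facts of relations outside the cycle.
    obtain ⟨r, hr₀r, hr⟩ := hfin.exists_le_maximal (a := r₀) ⟨Finset.filter_subset _ _, hr₀⟩
    intro hcert
    have hsat := hcert r hr
    rw [satisfies_iff hinj] at hsat
    rcases hsat with h | ⟨d, hd⟩
    · omega
    refine hfree d (hd.mono fun i hi => ?_)
    obtain ⟨A, hA, hAe⟩ := hi
    obtain ⟨e', he's, heq⟩ := htot _ ⟨A, hr.prop.1 hA, hAe⟩
    obtain ⟨B, hB, hBe'⟩ := hs he's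
    have hBr : B ∈ r := hr₀r (Finset.mem_filter.2 ⟨hB, e', he's, hBe'⟩)
    obtain rfl := hr.prop.2 A hA B hBr ((hAe.keyEqual_iff hinj harity hkey hBe').2 heq.symm)
    rw [hAe.unique hinj hBe']
    exact he's

theorem certainGraph_iff (hk : 2 ≤ k) (hinj : Function.Injective R)
    (harity : ∀ i, S.arity (R i) = 2) (hkey : ∀ i, S.keyLen (R i) = 1) {db : Database S}
    {E : List ((ℕ × Const) × (ℕ × Const))} (hE : ∀ e, e ∈ E ↔ ∃ A ∈ db, IsEdge R A e) :
    certainGraph k E = true ↔ db ∈ certainty (cycleQuery S R harity) := by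
  have hset : {e | e ∈ E} = edges R (db : Set (Fact S)) := Set.ext hE
  rw [← not_iff_not, not_certain_iff hk hinj harity hkey, Bool.not_eq_true,
    certainGraph_eq_false_iff hk (hset ▸ isLayered_edges _), ← hset]
  rfl

end repairs

/-! ### Parsing -/

section parsing
variable {Rel : Type}

/-- Natural numbers in unary. -/
def natTree : ℕ → Bintree
  | 0 => .nil
  | n + 1 => .node .nil (natTree n)

instance : Code ℕ where
  tree := natTree
  inj := by
    intro m
    induction m with
    | zero => intro n h; cases n <;> simp_all [natTree]
    | succ m ih =>
      intro n h
      cases n with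
      | zero => simp_all [natTree]
      | succ n =>
        simp only [natTree, Bintree.node.injEq, true_and] at h
        rw [ih h]

theorem finite_sym [Finite Rel] : Finite (Sym Rel) := by
  let f : Sym Rel → Option (Rel ⊕ Bool)
    | .rel R => some (.inl R)
    | .bit b => some (.inr b)
    | .sep => none
  refine Finite.of_injective f ?_
  intro x y h
  cases x <;> cases y <;> simp_all [f]

/-- Elements of a finite type are represented by numbers. -/
@[reducible] noncomputable def codeOfFinite (A : Type) [Finite A] : Code A where
  tree a := natTree (Finite.equivFin A a).val
  inj := fun _ _ h => (Finite.equivFin A).injective (Fin.ext (Code.inj (α := ℕ) h))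

/-- The edges of facts that have been parsed. -/
abbrev EdgeList : Type := List ((ℕ × Const) × (ℕ × Const))

/-- The state of the parser, which works from right to left: whether no error has occurred, the
edges of the facts parsed so far, and the arguments parsed since the last fact. -/
abbrev ParseState : Type := Bool × EdgeList × List Const

open Classical in
/-- Add the edge of a fact with relation name `r`, if there is one. -/
noncomputable def addEdge {k : ℕ} (R : Fin k → Rel) (r : Rel) (E : EdgeList) (args : List Const) :
    EdgeList :=
  if h : ∃ i, r = R i then
    ((h.choose.val, args.headI), ((h.choose.val + 1) % k, args.tail.headI)) :: E
  else E

/-- Parse one symbol. -/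
noncomputable def parseStep (S : Schema Rel) {k : ℕ} (R : Fin k → Rel) :
    Sym Rel → ParseState → ParseState
  | .sep, st => (st.1, st.2.1, [] :: st.2.2)
  | .bit b, st => if eqb st.2.2 [] = true then (false, st.2.1, st.2.2)
      else (st.1, st.2.1, (b :: st.2.2.headI) :: st.2.2.tail)
  | .rel r, st => (st.1 && eqb st.2.2.length (S.arity r), addEdge R r st.2.1 st.2.2, [])

/-- Parse a word. -/
noncomputable def parse (S : Schema Rel) {k : ℕ} (R : Fin k → Rel) (w : List (Sym Rel)) :
    ParseState := w.foldr (parseStep S R) (true, [], [])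

variable {S : Schema Rel} {k : ℕ} {R : Fin k → Rel}

theorem mem_addEdge (hinj : Function.Injective R) {A : Fact S} {E : EdgeList}
    {e : (ℕ × Const) × (ℕ × Const)} :
    e ∈ addEdge R A.rel E A.args ↔ IsEdge R A e ∨ e ∈ E := by
  unfold addEdge
  split_ifs with h
  · have h1 : IsEdge R A _ := ⟨h.choose, h.choose_spec, rfl⟩
    rw [List.mem_cons]
    exact or_congr_left ⟨fun h => h ▸ h1, fun h => h.unique hinj h1⟩
  · have h1 : ¬ IsEdge R A e := fun ⟨i, hi, _⟩ => h ⟨i, hi⟩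
    simp [h1]

/-- Invariant of the right-to-left scan: what has been read is the pending arguments followed by
complete facts. A relation name turns the pending arguments into a fact. -/
theorem parse_sound (hinj : Function.Injective R) (w : List (Sym Rel)) (h : (parse S R w).1 = true) :
    ∃ l : List (Fact S), w = (parse S R w).2.2.flatMap encodeConst ++ l.flatMap encodeFact ∧
      ∀ e, e ∈ (parse S R w).2.1 ↔ ∃ A ∈ l, IsEdge R A e := by
  induction w with
  | nil => exact ⟨[], by simp [parse], by simp [parse]⟩
  | cons a w ih =>
    have hcons : parse S R (a :: w) = parseStep S R a (parse S R w) := rfl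
    rw [hcons] at h ⊢
    generalize parse S R w = st at *
    obtain ⟨ok, E, args⟩ := st
    cases a with
    | sep =>
      obtain ⟨l, hw, hE⟩ := ih h
      exact ⟨l, by simpa [parseStep, encodeConst] using hw, hE⟩
    | bit b =>
      cases args with
      | nil => simp [parseStep, eqb] at h
      | cons c args =>
        simp only [parseStep, eqb_iff, reduceCtorEq, if_false] at h ⊢
        obtain ⟨l, hw, hE⟩ := ih h
        exact ⟨l, by simpa [encodeConst] using hw, hE⟩
    | rel r =>
      simp only [parseStep, Bool.and_eq_true, eqb_iff] at h ⊢
      obtain ⟨l, hw, hE⟩ := ih h.1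
      let A : Fact S := ⟨r, args, h.2⟩
      refine ⟨A :: l, by simpa [encodeFact, A] using hw, fun e => ?_⟩
      rw [List.exists_mem_cons_iff, ← hE e]
      exact mem_addEdge (A := A) hinj

theorem parse_args (args args' : List Const) (E : EdgeList) :
    (args.flatMap encodeConst).foldr (parseStep S R) (true, E, args') = (true, E, args ++ args') := by
  induction args with
  | nil => rfl
  | cons c args ih =>
    rw [List.flatMap_cons, List.foldr_append, ih, encodeConst, List.foldr_append]
    induction c with
    | nil => rfl
    | cons b c ihc =>
      rw [List.map_cons, List.foldr_cons, ihc]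
      simp [parseStep, eqb]

theorem parse_complete (hinj : Function.Injective R) (l : List (Fact S)) :
    ∃ E, parse S R (l.flatMap encodeFact) = (true, E, []) ∧ ∀ e, e ∈ E ↔ ∃ A ∈ l, IsEdge R A e := by
  induction l with
  | nil => exact ⟨[], rfl, by simp⟩
  | cons A l ih =>
    obtain ⟨E, h, hE⟩ := ih
    refine ⟨addEdge R A.rel E A.args, ?_, fun e => ?_⟩
    · rw [parse] at h
      rw [parse, List.flatMap_cons, List.foldr_append, h, encodeFact, List.foldr_cons, parse_args]
      simp [parseStep, A.length_args]
    · rw [mem_addEdge hinj, List.exists_mem_cons_iff, hE]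

/-- The decision procedure, working on the reversal of the input. -/
noncomputable def decideCycle (S : Schema Rel) {k : ℕ} (R : Fin k → Rel) (w : List (Sym Rel)) :
    Bool :=
  let st := w.foldl (fun st a => parseStep S R a st) (true, [], [])
  st.1 && (eqb st.2.2 [] && certainGraph k st.2.1)

/-- A word is an encoding when the parser finds no error and no argument is left pending. Order and
repetition of facts are harmless, since only the set of edges matters. -/
theorem decideCycle_iff (hk : 2 ≤ k) (hinj : Function.Injective R)
    (harity : ∀ i, S.arity (R i) = 2) (hkey : ∀ i, S.keyLen (R i) = 1) (w : List (Sym Rel)) :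
    decideCycle S R w.reverse = true ↔
      w ∈ problemLanguage (certainty (cycleQuery S R harity)) := by
  classical
  have h1 : w.reverse.foldl (fun st a => parseStep S R a st) (true, [], []) = parse S R w := by
    rw [List.foldl_reverse]; rfl
  rw [decideCycle, h1]
  simp only [Bool.and_eq_true, eqb_iff]
  constructor
  · rintro ⟨hok, hargs, hcert⟩
    obtain ⟨l, hw, hE⟩ := parse_sound hinj w hok
    refine ⟨l.toFinset, ?_, l, by simp, by rw [hargs] at hw; simpa using hw⟩
    exact (certainGraph_iff hk hinj harity hkey (by simpa using hE)).1 hcert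
  · rintro ⟨db, hdb, l, hl, rfl⟩
    obtain ⟨E, h, hE⟩ := parse_complete hinj l
    rw [h]
    exact ⟨rfl, rfl, (certainGraph_iff hk hinj harity hkey (by simpa only [hl] using hE)).2 hdb⟩

theorem PT.length_eq {α : Type} [Code α] (n : ℕ) :
    PT (fun l : List α => CQA.eqb l.length n) := by
  induction n with
  | zero =>
    have h : (fun l : List α => CQA.eqb l.length 0) = fun l => CQA.eqb l [] := by
      funext l; simp [CQA.eqb]
    rw [h]
    exact PT.eqb PT.id (PT.const _)
  | succ n ih =>
    have h : (fun l : List α => CQA.eqb l.length (n + 1)) =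
        fun l => !CQA.eqb l [] && CQA.eqb l.tail.length n := by
      funext l; rw [Bool.eq_iff_iff]; cases l <;> simp [← Bool.not_eq_true]
    rw [h]
    exact (PT.not (PT.eqb PT.id (PT.const _))).and (ih.comp PT.tail)

theorem PT.parseStep (S : Schema Rel) (R : Fin k → Rel) (a : Sym Rel) :
    PT (CQA.parseStep S R a) := by
  have hok : PT (fun st : ParseState => st.1) := PT.fst
  have hE : PT (fun st : ParseState => st.2.1) := PT.left PT.snd
  have hargs : PT (fun st : ParseState => st.2.2) := PT.right PT.snd
  cases a with
  | sep => exact hok.pair (hE.pair (PT.cons (PT.const []) hargs))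
  | bit b =>
    exact PT.ite (PT.eqb hargs (PT.const [])) ((PT.const false).pair (hE.pair hargs))
      (hok.pair (hE.pair (PT.cons (PT.cons (PT.const b) (PT.head.comp hargs))
        (PT.tail.comp hargs))))
  | rel r =>
    refine (hok.and ((PT.length_eq (S.arity r)).comp hargs)).pair (PT.pair ?_ (PT.const []))
    unfold addEdge
    split_ifs with h
    · exact PT.cons (((PT.const h.choose.val).pair (PT.head.comp hargs)).pair
        ((PT.const ((h.choose.val + 1) % k)).pair (PT.head.comp (PT.tail.comp hargs)))) hE
    · exact hE

-- A relation name moves the pending arguments into an edge instead of copying them, so each symbol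
-- adds only a constant, as `PT.foldl` requires.
open Classical in
theorem size_parseStep_le (S : Schema Rel) (R : Fin k → Rel) (a : Sym Rel) :
    ∃ C, ∀ st, size (CQA.parseStep S R a st) ≤ size st + C := by
  have hpos : ∀ b : Bool, 1 ≤ size b := by intro b; cases b <;> simp [size, code_false, code_true]
  cases a with
  | sep => exact ⟨2, fun st => by simp only [CQA.parseStep, size_prod, size_cons, size_nil]; omega⟩
  | bit b =>
    refine ⟨size b + 1, fun st => ?_⟩
    obtain ⟨ok, E, args⟩ := st
    have := hpos ok
    cases args with
    | nil =>
      simp [CQA.parseStep, size_prod]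
      simp [size, code_false] at *
      omega
    | cons c args =>
      simp only [CQA.parseStep, eqb_iff, reduceCtorEq, if_false, size_prod, size_cons,
        List.headI_cons, List.tail_cons]
      omega
  | rel r =>
    refine ⟨if h : ∃ i, r = R i then size h.choose.val + size ((h.choose.val + 1) % k) + 10 else 10,
      fun st => ?_⟩
    obtain ⟨ok, E, args⟩ := st
    have h1 := size_bool_le (ok && CQA.eqb args.length (S.arity r))
    -- The `1` is needed for an empty argument list, where both entries default to the empty
    -- constant.
    have h2 : size args.headI + size args.tail.headI ≤ size args + 1 := by
      rcases args with _ | ⟨a, _ | ⟨b, args⟩⟩ <;>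
        simp only [List.headI_cons, List.headI_nil, List.tail_cons, List.tail_nil, size_cons,
          size_nil, show (default : Const) = [] from rfl] <;> omega
    simp only [CQA.parseStep, addEdge, size_prod, size_nil]
    split_ifs
    · simp only [size_prod, size_cons]; omega
    · have : 1 ≤ size args := by cases args <;> simp [size_nil, size_cons]
      omega

theorem PT.decideCycle [Finite Rel] [Finite (Sym Rel)] [Code (Sym Rel)] (S : Schema Rel)
    (R : Fin k → Rel) : PT (CQA.decideCycle S R) := by
  have : Inhabited (Sym Rel) := ⟨.sep⟩
  choose C hC using size_parseStep_le S R
  obtain ⟨M, hM⟩ := (Set.finite_range C).bddAbove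
  have hfold : PT (fun w : List (Sym Rel) =>
      w.foldl (fun st a => CQA.parseStep S R a st) (true, [], [])) :=
    PT.foldl (i := fun _ => ((true, [], []) : ParseState)) (g := fun _ st a => CQA.parseStep S R a st)
      PT.id (PT.const _) ((PT.finite_cases (PT.parseStep S R)).comp
        ((PT.right PT.snd).pair (PT.left PT.snd))) (Polynomial.C M) (fun _ st a _ => by
          have h1 := hC a st
          have h2 : C a ≤ M := hM ⟨a, rfl⟩
          rw [Polynomial.eval_C]
          omega)
  exact (PT.left hfold).and ((PT.eqb (PT.right (PT.right hfold)) (PT.const [])).and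
    ((PT.certainGraph k).comp (PT.left (PT.right hfold))))

end parsing

end CQA

theorem corollary4 {Rel : Type} [Finite Rel] (S : CQA.Schema Rel) (k : ℕ) (hk : 2 ≤ k)
    (R : Fin k → Rel) (hinj : Function.Injective R)
    (harity : ∀ i, S.arity (R i) = 2) (hkey : ∀ i, S.keyLen (R i) = 1) :
    CQA.InP (CQA.problemLanguage (CQA.certainty (CQA.cycleQuery S R harity))) := by
  have := CQA.finite_sym (Rel := Rel)
  let := CQA.codeOfFinite (CQA.Sym Rel)
  exact CQA.inP_of_pt (CQA.PT.decideCycle S R) (CQA.decideCycle_iff hk hinj harity hkey)
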